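/- Let $(M,g)$ be a smooth Riemannian manifold (Hausdorff, without boundary) of dimension $n\ge 1$ with Levi-Civita connection $\nabla^g$, and let $\nabla$ be a smooth metric connection on $M$ whose torsion is totally skew-symmetric, i.e. $T(X,Y,Z)=g(\nabla_XY-\nabla_YX-[X,Y],Z)$ is a 3-form. Conventions. Let $e_1,\dots,e_n$ denote an orthonormal basis of a tangent space; repeated indices are summed from $1$ to $n$. Put $R(X,Y)Z=[\nabla_X,\nabla_Y]Z-\nabla_{[X,Y]}Z$, $R(X,Y,Z,V)=g(R(X,Y)Z,V)$, $Ric(X,Y)=R(e_i,X,Y,e_i)$, $Scal=Ric(e_i,e_i)$, and let $Scal^g$ be the scalar curvature of $\nabla^g$. Put $T^2_{ij}=T_{iab}T_{jab}$, $\|T\|^2=T_{abc}T_{abc}$, $(\delta T)_{ij}=-\nabla^g_sT_{sij}$, and define the 1-forms $\theta_j=(\delta T)_{ab}T_{jab}$ and $\Theta_j=T_{abc}(dT)_{jabc}$. We say that $T$ is harmonic if $dT=0$ and $\delta T=0$, and that $R\in S^2\Lambda^2$ if $R(X,Y,Z,V)=R(Z,V,X,Y)$ for all $X,Y,Z,V$.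 Suppose that $\nabla$ is $\nabla$-Einstein: there is a function $\lambda$ on $M$ with $\frac12\big(Ric(X,Y)+Ric(Y,X)\big)=\lambda\, g(X,Y)$ for all $X,Y$. a) The following identity holds on $M$: $$\frac{n-2}{n}\,d(Scal)_j-\frac12\nabla^g_sT^2_{sj}+\frac14\, d(\|T\|^2)_j=0 .$$ Suppose in b) and c) that $M$ is connected and $n\neq 2$. b) If $3\theta+\Theta=0$, then there is a constant $C$ such that $$Scal=-\frac{n}{6(n-2)}\|T\|^2+C\quad\text{and}\quad Scal^g=Scal+\frac14\|T\|^2=\frac{n-6}{12(n-2)}\|T\|^2+C .$$ In particular, this holds if $T$ is harmonic. c) If $R\in S^2\Lambda^2$, then there is a constant $B$ such that $$Scal=-\frac{n}{2(n-2)}\|T\|^2+B\quad\text{and}\quad Scal^g=-\frac{n+2}{4(n-2)}\|T\|^2+B .$$ In particular, if in b) or in c) $Scal$ is constant, then $\|T\|^2$ is constant. -/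

import Mathlib

open scoped Manifold ContDiff Bundle

namespace SkewTorsion

noncomputable section

variable {n : ℕ} {M : Type*} [TopologicalSpace M] [ChartedSpace (EuclideanSpace ℝ (Fin n)) M]

/-- An affine connection `∇` on `M`. In Mathlib's argument order `nabla Y x u` is `(∇_u Y)(x)`. -/
abbrev Connection (n : ℕ) (M : Type*) [TopologicalSpace M]
    [ChartedSpace (EuclideanSpace ℝ (Fin n)) M] [IsManifold (𝓡 n) ∞ M] :=
  CovariantDerivative (𝓡 n) (EuclideanSpace ℝ (Fin n)) (fun x : M => TangentSpace (𝓡 n) x)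

/-- A smooth vector field near `x` with value `u` at `x` (constant coefficients in the preferred
chart at `x`). All expressions below in which it occurs are tensorial, so that they do not depend on
the choice of the extension. -/
abbrev ext {x : M} (u : TangentSpace (𝓡 n) x) [IsManifold (𝓡 n) ∞ M] :
    Π y : M, TangentSpace (𝓡 n) y :=
  FiberBundle.extend (EuclideanSpace ℝ (Fin n)) u

section NoMetric

variable [IsManifold (𝓡 n) ∞ M]

/-- `R(X, Y) Z = ∇_X ∇_Y Z - ∇_Y ∇_X Z - ∇_[X,Y] Z` for vector fields. -/
def curvatureField (nabla : Connection n M) (X Y Z : Π y : M, TangentSpace (𝓡 n) y) (x : M) :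
    TangentSpace (𝓡 n) x :=
  nabla (fun y => nabla Z y (Y y)) x (X x) - nabla (fun y => nabla Z y (X y)) x (Y x)
    - nabla Z x (VectorField.mlieBracket (𝓡 n) X Y x)

/-- The curvature endomorphism `R(u, v) w` for tangent vectors at `x`. -/
def curvature (nabla : Connection n M) (x : M) (u v w : TangentSpace (𝓡 n) x) :
    TangentSpace (𝓡 n) x :=
  curvatureField nabla (ext u) (ext v) (ext w) x

/-- The covariant derivative `(∇_z B)(u, v)` of a covariant 2-tensor field. -/
def covDeriv₂ (nabla : Connection n M)
    (B : Π y : M, TangentSpace (𝓡 n) y → TangentSpace (𝓡 n) y → ℝ)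
    (x : M) (z u v : TangentSpace (𝓡 n) x) : ℝ :=
  mvfderiv (𝓡 n) (fun y => B y (ext u y) (ext v y)) x z
    - B x (nabla (ext u) x z) v - B x u (nabla (ext v) x z)

/-- The covariant derivative `(∇_z A)(u, v, w)` of a covariant 3-tensor field. -/
def covDeriv₃ (nabla : Connection n M)
    (A : Π y : M, TangentSpace (𝓡 n) y → TangentSpace (𝓡 n) y → TangentSpace (𝓡 n) y → ℝ)
    (x : M) (z u v w : TangentSpace (𝓡 n) x) : ℝ :=
  mvfderiv (𝓡 n) (fun y => A y (ext u y) (ext v y) (ext w y)) x z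
    - A x (nabla (ext u) x z) v w - A x u (nabla (ext v) x z) w - A x u v (nabla (ext w) x z)

/-- The exterior derivative of a 3-form `A` by the invariant formula
`dA(X₀,…,X₃) = ∑ᵢ (-1)ⁱ Xᵢ(A(…,X̂ᵢ,…)) + ∑_{i<j} (-1)^{i+j} A([Xᵢ,Xⱼ],…,X̂ᵢ,…,X̂ⱼ,…)`. -/
def extDeriv₃
    (A : Π y : M, TangentSpace (𝓡 n) y → TangentSpace (𝓡 n) y → TangentSpace (𝓡 n) y → ℝ)
    (x : M) (u₀ u₁ u₂ u₃ : TangentSpace (𝓡 n) x) : ℝ :=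
  mvfderiv (𝓡 n) (fun y => A y (ext u₁ y) (ext u₂ y) (ext u₃ y)) x u₀
    - mvfderiv (𝓡 n) (fun y => A y (ext u₀ y) (ext u₂ y) (ext u₃ y)) x u₁
    + mvfderiv (𝓡 n) (fun y => A y (ext u₀ y) (ext u₁ y) (ext u₃ y)) x u₂
    - mvfderiv (𝓡 n) (fun y => A y (ext u₀ y) (ext u₁ y) (ext u₂ y)) x u₃
    - A x (VectorField.mlieBracket (𝓡 n) (ext u₀) (ext u₁) x) u₂ u₃
    + A x (VectorField.mlieBracket (𝓡 n) (ext u₀) (ext u₂) x) u₁ u₃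
    - A x (VectorField.mlieBracket (𝓡 n) (ext u₀) (ext u₃) x) u₁ u₂
    - A x (VectorField.mlieBracket (𝓡 n) (ext u₁) (ext u₂) x) u₀ u₃
    + A x (VectorField.mlieBracket (𝓡 n) (ext u₁) (ext u₃) x) u₀ u₂
    - A x (VectorField.mlieBracket (𝓡 n) (ext u₂) (ext u₃) x) u₀ u₁

end NoMetric

theorem finrank_tangentSpace (x : M) : Module.finrank ℝ (TangentSpace (𝓡 n) x) = n := by
  change Module.finrank ℝ (EuclideanSpace ℝ (Fin n)) = n
  simp

instance finiteDimensional_tangentSpace (x : M) :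
    FiniteDimensional ℝ (TangentSpace (𝓡 n) x) :=
  inferInstanceAs (FiniteDimensional ℝ (EuclideanSpace ℝ (Fin n)))

variable [Bundle.RiemannianBundle (fun x : M => TangentSpace (𝓡 n) x)]

/-- An orthonormal basis `e₁, …, eₙ` of the tangent space at `x`. The traces below do not depend on
which one is taken, and nothing is assumed about the dependence on `x`. -/
def frame (x : M) : OrthonormalBasis (Fin n) ℝ (TangentSpace (𝓡 n) x) :=
  (stdOrthonormalBasis ℝ (TangentSpace (𝓡 n) x)).reindex (finCongr (finrank_tangentSpace x))

/-! ### Algebra of a covariant 3-tensor field -/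

/-- `T²(u, v) = ∑ T(u, e_a, e_b) T(v, e_a, e_b)`. -/
def tensorSq
    (T : Π y : M, TangentSpace (𝓡 n) y → TangentSpace (𝓡 n) y → TangentSpace (𝓡 n) y → ℝ)
    (x : M) (u v : TangentSpace (𝓡 n) x) : ℝ :=
  ∑ a, ∑ b, T x u (frame x a) (frame x b) * T x v (frame x a) (frame x b)

/-- `‖T‖² = ∑ T(e_a, e_b, e_c)²`, the sum over all triples of indices. -/
def normSq
    (T : Π y : M, TangentSpace (𝓡 n) y → TangentSpace (𝓡 n) y → TangentSpace (𝓡 n) y → ℝ)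
    (x : M) : ℝ :=
  ∑ a, ∑ b, ∑ c, T x (frame x a) (frame x b) (frame x c) ^ 2

variable [IsManifold (𝓡 n) ∞ M]

/-! ### Curvatures of a connection -/

/-- `R(X, Y, Z, V) = g(R(X, Y) Z, V)`. -/
def curvature₄ (nabla : Connection n M) (x : M) (X Y Z V : TangentSpace (𝓡 n) x) : ℝ :=
  inner ℝ (curvature nabla x X Y Z) V

/-- `Ric(X, Y) = ∑ R(e_i, X, Y, e_i)`. -/
def ricci (nabla : Connection n M) (x : M) (X Y : TangentSpace (𝓡 n) x) : ℝ :=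
  ∑ i, curvature₄ nabla x (frame x i) X Y (frame x i)

/-- `Scal = ∑ Ric(e_i, e_i)`. -/
def scal (nabla : Connection n M) (x : M) : ℝ :=
  ∑ i, ricci nabla x (frame x i) (frame x i)

/-- The symmetric part of the Ricci tensor is a scalar multiple of the metric; the factor may be a
function on `M`. -/
def IsNablaEinstein (nabla : Connection n M) : Prop :=
  ∃ lam : M → ℝ, ∀ (x : M) (X Y : TangentSpace (𝓡 n) x),
    (ricci nabla x X Y + ricci nabla x Y X) / 2 = lam x * inner ℝ X Y

/-- `R ∈ S²Λ²`, that is, `R(X, Y, Z, V) = R(Z, V, X, Y)`. -/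
def CurvaturePairSymmetric (nabla : Connection n M) : Prop :=
  ∀ (x : M) (X Y Z V : TangentSpace (𝓡 n) x),
    curvature₄ nabla x X Y Z V = curvature₄ nabla x Z V X Y

/-! ### Torsion, the Levi-Civita connection, codifferential and torsion 1-forms -/

/-- `T(u, v, w) = g(T(u, v), w)`, where `T(X, Y) = ∇_X Y - ∇_Y X - [X, Y]`. -/
def torsionForm (nabla : Connection n M) (x : M) (u v w : TangentSpace (𝓡 n) x) : ℝ :=
  inner ℝ (nabla.torsion x u v) w

/-- The divergence `(div B)(v) = ∑ (∇_{e_s} B)(e_s, v)` of a covariant 2-tensor field. -/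
def divergence₂ (nabla : Connection n M)
    (B : Π y : M, TangentSpace (𝓡 n) y → TangentSpace (𝓡 n) y → ℝ)
    (x : M) (v : TangentSpace (𝓡 n) x) : ℝ :=
  ∑ s, covDeriv₂ nabla B x (frame x s) (frame x s) v

/-- The codifferential `δT(u, v) = -∑ (∇ᵍ_{e_s} T)(e_s, u, v)` of a 3-form, where `nablaG` is the
Levi-Civita connection `∇ᵍ`. -/
def codiff₃ (nablaG : Connection n M)
    (T : Π y : M, TangentSpace (𝓡 n) y → TangentSpace (𝓡 n) y → TangentSpace (𝓡 n) y → ℝ)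
    (x : M) (u v : TangentSpace (𝓡 n) x) : ℝ :=
  -∑ s, covDeriv₃ nablaG T x (frame x s) (frame x s) u v

/-- `θ(v) = ∑ δT(e_a, e_b) T(v, e_a, e_b)`. -/
def smallTheta (nablaG : Connection n M)
    (T : Π y : M, TangentSpace (𝓡 n) y → TangentSpace (𝓡 n) y → TangentSpace (𝓡 n) y → ℝ)
    (x : M) (v : TangentSpace (𝓡 n) x) : ℝ :=
  ∑ a, ∑ b, codiff₃ nablaG T x (frame x a) (frame x b) * T x v (frame x a) (frame x b)

/-- `Θ(v) = ∑ T(e_a, e_b, e_c) dT(v, e_a, e_b, e_c)`. -/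
def bigTheta
    (T : Π y : M, TangentSpace (𝓡 n) y → TangentSpace (𝓡 n) y → TangentSpace (𝓡 n) y → ℝ)
    (x : M) (v : TangentSpace (𝓡 n) x) : ℝ :=
  ∑ a, ∑ b, ∑ c, T x (frame x a) (frame x b) (frame x c) *
    extDeriv₃ T x v (frame x a) (frame x b) (frame x c)

/-- The 3-form `T` is harmonic: `dT = 0` and `δT = 0`. -/
def IsHarmonic₃ (nablaG : Connection n M)
    (T : Π y : M, TangentSpace (𝓡 n) y → TangentSpace (𝓡 n) y → TangentSpace (𝓡 n) y → ℝ) :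
    Prop :=
  (∀ (x : M) (u₀ u₁ u₂ u₃ : TangentSpace (𝓡 n) x), extDeriv₃ T x u₀ u₁ u₂ u₃ = 0) ∧
    ∀ (x : M) (u v : TangentSpace (𝓡 n) x), codiff₃ nablaG T x u v = 0

variable
  [IsContMDiffRiemannianBundle (𝓡 n) ∞ (EuclideanSpace ℝ (Fin n))
    (fun x : M => TangentSpace (𝓡 n) x)]

instance isContMDiffRiemannianBundle_one :
    IsContMDiffRiemannianBundle (𝓡 n) 1 (EuclideanSpace ℝ (Fin n))
      (fun x : M => TangentSpace (𝓡 n) x) :=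
  IsContMDiffRiemannianBundle.of_le (n := ∞) (by norm_cast)

/-- A smooth metric connection whose torsion is totally skew-symmetric. -/
structure IsMetricWithSkewTorsion (nabla : Connection n M) : Prop where
  smooth : CovariantDerivative.ContMDiffCovariantDerivative nabla ∞
  metric : nabla.IsMetricCompatible
  skew₁₂ : ∀ (x : M) (u v w : TangentSpace (𝓡 n) x),
    torsionForm nabla x u v w = -torsionForm nabla x v u w
  skew₂₃ : ∀ (x : M) (u v w : TangentSpace (𝓡 n) x),
    torsionForm nabla x u v w = -torsionForm nabla x u w v

/-- The Levi-Civita connection: metric and torsion-free. -/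
structure IsLeviCivita (nablaG : Connection n M) : Prop where
  metric : nablaG.IsMetricCompatible
  torsion_eq_zero : nablaG.torsion = 0

end

end SkewTorsion

/-!
In a chart the Christoffel symbols of `∇` are `Γ = S + ½τ`, where the symmetric part `S` belongs to
`∇ᵍ` and `τ` is the torsion: total skew-symmetry makes `∂ + S` metric, and a metric torsion-free
connection is unique. Expanding the curvature of `Γ` gives `½(Ric(X, Y) + Ric(Y, X)) = Ricᵍ - ¼T²`,
so the `∇`-Einstein condition reads `Ricᵍ = (Scal / n) g + ¼T²`. Taking the divergence and using the
contracted second Bianchi identity `div Ricᵍ = ½ d Scalᵍ` and `Scalᵍ = Scal + ¼‖T‖²` gives a).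

For b) and c) one writes `div T²` as a multiple of `d‖T‖²`. By the product rule `div T²` is
`-θ_j + T_{sab} ∇ᵍ_s T_{jab}`. Contracting `dT_{jsab}`, the alternation of `∇ᵍT`, with `T_{sab}`
gives `Θ_j = ½ d(‖T‖²)_j - 3 T_{sab} ∇ᵍ_s T_{jab}`; in case c) pair symmetry of `R` makes `∇ᵍT`
totally skew, and the last sum is `-½ d(‖T‖²)_j` while `θ = 0`. Substituted in a), this makes the
differential of `Scal` plus a multiple of `‖T‖²` vanish on a connected manifold.
-/

namespace SkewTorsion

set_option maxSynthPendingDepth 3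

open scoped Topology

section OrthonormalFamilies

variable {ι K V : Type*} [DecidableEq ι] [Field K] [AddCommGroup V] [Module K V]

/-- The family `b` is orthonormal for the bilinear form `G`, which need not be definite. -/
def IsOrthonormalFor (G : LinearMap.BilinForm K V) (b : ι → V) : Prop :=
  ∀ i j, G (b i) (b j) = if i = j then 1 else 0

namespace IsOrthonormalFor

variable {G : LinearMap.BilinForm K V} {b c : ι → V}

theorem linearIndependent (hb : IsOrthonormalFor G b) : LinearIndependent K b := by
  rw [linearIndependent_iff']
  intro s a ha i hi
  simpa [hb _ _, hi] using congrArg (fun u => G u (b i)) ha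

variable [Fintype ι] [FiniteDimensional K V]

/-- An orthonormal family with `finrank K V` members, as a basis. -/
noncomputable def basis (hb : IsOrthonormalFor G b) (hn : Module.finrank K V = Fintype.card ι) :
    Module.Basis ι K V :=
  .mk hb.linearIndependent (hb.linearIndependent.span_eq_top_of_card_eq_finrank' hn.symm).ge

@[simp]
theorem coe_basis (hb : IsOrthonormalFor G b) (hn : Module.finrank K V = Fintype.card ι) :
    ⇑(hb.basis hn) = b :=
  Module.Basis.coe_mk _ _

theorem toMatrix_basis (hb : IsOrthonormalFor G b) (hn : Module.finrank K V = Fintype.card ι) :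
    LinearMap.BilinForm.toMatrix (hb.basis hn) G = 1 := by
  ext i j
  simp [LinearMap.BilinForm.toMatrix_apply, Matrix.one_apply, hb i j]

theorem eq_sum_smul (hb : IsOrthonormalFor G b) (hn : Module.finrank K V = Fintype.card ι)
    (u : V) : u = ∑ i, G u (b i) • b i := by
  have repr_eq (i : ι) : (hb.basis hn).repr u i = G u (b i) := by
    conv_rhs => rw [← (hb.basis hn).sum_repr u]
    simp [hb _ _]
  conv_lhs => rw [← (hb.basis hn).sum_repr u]
  simp [repr_eq]

theorem sum_apply_mul (hb : IsOrthonormalFor G b) (hn : Module.finrank K V = Fintype.card ι)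
    (φ : V →ₗ[K] K) (u : V) : ∑ i, G u (b i) * φ (b i) = φ u := by
  conv_rhs => rw [hb.eq_sum_smul hn u]
  simp

theorem sum_apply_apply (hc : IsOrthonormalFor G c) (hn : Module.finrank K V = Fintype.card ι)
    (b : Module.Basis ι K V) (A : LinearMap.BilinForm K V) :
    ∑ a, A (c a) (c a) = ∑ i, ∑ j,
      (LinearMap.BilinForm.toMatrix b G)⁻¹ i j * A (b i) (b j) := by
  have gram_inv : (LinearMap.BilinForm.toMatrix b G)⁻¹ =
      b.toMatrix (hc.basis hn) * (b.toMatrix (hc.basis hn)).transpose := by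
    have h := (LinearMap.BilinForm.toMatrix_mul_basis_toMatrix b (hc.basis hn) G).trans
      (hc.toMatrix_basis hn)
    rw [Matrix.mul_assoc, mul_eq_one_comm, Matrix.mul_assoc] at h
    exact Matrix.inv_eq_right_inv h
  calc ∑ a, A (c a) (c a)
      = (LinearMap.BilinForm.toMatrix (hc.basis hn) A).trace := by
        simp [Matrix.trace, LinearMap.BilinForm.toMatrix_apply]
    _ = ((LinearMap.BilinForm.toMatrix b G)⁻¹.transpose *
          LinearMap.BilinForm.toMatrix b A).trace := by
        rw [← LinearMap.BilinForm.toMatrix_mul_basis_toMatrix b, Matrix.trace_mul_comm, gram_inv,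
          Matrix.transpose_mul, Matrix.transpose_transpose, Matrix.mul_assoc]
    _ = _ := by
        rw [Matrix.trace, Finset.sum_comm]
        simp [Matrix.mul_apply, LinearMap.BilinForm.toMatrix_apply]

end IsOrthonormalFor

end OrthonormalFamilies

section DerivativeOfTrace

variable {𝕜 E : Type*} [NontriviallyNormedField 𝕜] [NormedAddCommGroup E] [NormedSpace 𝕜 E] {p : E}

theorem hasFDerivAt_ringInverse_comp {R : Type*} [NormedRing R] [CompleteSpace R]
    [NormedAlgebra 𝕜 R] {X : E → R} {X' : E →L[𝕜] R} (hX : HasFDerivAt X X' p)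
    (hp : IsUnit (X p)) :
    HasFDerivAt (fun z => Ring.inverse (X z))
      (-(ContinuousLinearMap.mulLeftRight 𝕜 R (Ring.inverse (X p)) (Ring.inverse (X p))).comp X')
      p := by
  obtain ⟨U, hU⟩ := hp
  have h := hasFDerivAt_ringInverse (𝕜 := 𝕜) U
  rw [hU] at h
  refine (h.comp p hX).congr_fderiv ?_
  rw [← hU, Ring.inverse_unit, ContinuousLinearMap.neg_comp]

theorem hasFDerivAt_matrix_inv {m : Type*} [Fintype m] [DecidableEq m] [CompleteSpace 𝕜]
    {X : E → Matrix m m 𝕜} {X' : m → m → E →L[𝕜] 𝕜}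
    (hX : ∀ i j, HasFDerivAt (fun z => X z i j) (X' i j) p) (hp : IsUnit (X p)) (i j : m) :
    HasFDerivAt (fun z => (X z)⁻¹ i j)
      (-∑ k, ∑ l, ((X p)⁻¹ i k * (X p)⁻¹ l j) • X' k l) p := by
  let normedRing := Matrix.linftyOpNormedRing (n := m) (α := 𝕜)
  let _ := Matrix.linftyOpNormedAlgebra (n := m) (R := 𝕜) (α := 𝕜)
  have : @CompleteSpace (Matrix m m 𝕜) normedRing.toUniformSpace := FiniteDimensional.complete 𝕜 _
  have hasFDerivAt_X :
      HasFDerivAt X (∑ k, ∑ l, (X' k l).smulRight (Matrix.single k l (1 : 𝕜))) p := by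
    have X_eq : X = fun z => ∑ k, ∑ l, X z k l • Matrix.single k l (1 : 𝕜) := by
      funext z
      conv_lhs => rw [Matrix.matrix_eq_sum_single (X z)]
      simp
    rw [X_eq]
    exact HasFDerivAt.fun_sum fun k _ => HasFDerivAt.fun_sum fun l _ => (hX k l).smul_const _
  let entry : Matrix m m 𝕜 →L[𝕜] 𝕜 :=
    LinearMap.toContinuousLinearMap (Matrix.entryLinearMap 𝕜 𝕜 i j)
  have h := entry.hasFDerivAt.comp p (hasFDerivAt_ringInverse_comp hasFDerivAt_X hp)
  have inv_eq : (fun z => (X z)⁻¹ i j) = entry ∘ fun z => Ring.inverse (X z) := by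
    funext z
    simp [entry, Matrix.nonsing_inv_eq_ringInverse]
  rw [inv_eq]
  refine h.congr_fderiv (ContinuousLinearMap.ext fun v => ?_)
  change -((Ring.inverse (X p) * (∑ k, ∑ l, (X' k l).smulRight (Matrix.single k l (1 : 𝕜))) v *
    Ring.inverse (X p)) i j) = _
  simp only [← Matrix.nonsing_inv_eq_ringInverse, sum_apply,
    ContinuousLinearMap.smulRight_apply, Matrix.mul_sum, Matrix.sum_mul, Matrix.mul_smul,
    Matrix.smul_mul, Matrix.sum_apply, Matrix.smul_apply, neg_apply, smul_apply, smul_eq_mul]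
  simp [Matrix.mul_apply, Matrix.single_apply, ite_and, mul_comm]

theorem hasFDerivAt_orthonormal_trace {ι V : Type*} [Fintype ι] [DecidableEq ι] [CompleteSpace 𝕜]
    [AddCommGroup V] [Module 𝕜 V] [FiniteDimensional 𝕜 V]
    {G : E → LinearMap.BilinForm 𝕜 V} {A : E → V → V → 𝕜} {G' A' : V → V → E →L[𝕜] 𝕜}
    {c : E → ι → V} (hn : Module.finrank 𝕜 V = Fintype.card ι)
    (hG : ∀ u v, HasFDerivAt (fun z => G z u v) (G' u v) p)
    (hc : ∀ᶠ z in 𝓝 p, IsOrthonormalFor (G z) (c z))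
    (hA : ∀ᶠ z in 𝓝 p, IsBilinearMap 𝕜 (A z))
    (hA' : ∀ u v, HasFDerivAt (fun z => A z u v) (A' u v) p) :
    HasFDerivAt (fun z => ∑ a, A z (c z a) (c z a))
      (∑ i, A' (c p i) (c p i) - ∑ i, ∑ j, A p (c p i) (c p j) • G' (c p i) (c p j)) p := by
  -- The frame `c` need not be continuous, so the trace is first expressed in the fixed basis `c p`.
  let b : Module.Basis ι 𝕜 V := hc.self_of_nhds.basis hn
  have b_eq : ⇑b = c p := hc.self_of_nhds.coe_basis hn
  have trace_eq : (fun z => ∑ a, A z (c z a) (c z a)) =ᶠ[𝓝 p] fun z => ∑ i, ∑ j,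
      (LinearMap.BilinForm.toMatrix b (G z))⁻¹ i j * A z (b i) (b j) := by
    filter_upwards [hc, hA] with z hcz hAz
    exact hcz.sum_apply_apply hn b hAz.toLinearMap
  have gram_one : LinearMap.BilinForm.toMatrix b (G p) = 1 := hc.self_of_nhds.toMatrix_basis hn
  have gram_inv (i j : ι) := hasFDerivAt_matrix_inv
    (X := fun z => LinearMap.BilinForm.toMatrix b (G z)) (X' := fun i j => G' (b i) (b j))
    (fun i j => by simpa only [LinearMap.BilinForm.toMatrix_apply] using hG (b i) (b j))
    (by simp [gram_one]) i j
  have h := HasFDerivAt.fun_sum fun i (_ : i ∈ Finset.univ) =>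
    HasFDerivAt.fun_sum fun j (_ : j ∈ Finset.univ) => (gram_inv i j).mul (hA' (b i) (b j))
  refine (h.congr_of_eventuallyEq trace_eq).congr_fderiv ?_
  simp only [gram_one, inv_one, Matrix.one_apply, b_eq]
  simp [Finset.sum_add_distrib, sub_eq_add_neg]

end DerivativeOfTrace

section BilinearCalculus

variable {𝕜 E A B C D : Type*} [NontriviallyNormedField 𝕜] [NormedAddCommGroup E] [NormedSpace 𝕜 E]
  [NormedAddCommGroup A] [NormedSpace 𝕜 A] [NormedAddCommGroup B] [NormedSpace 𝕜 B]
  [NormedAddCommGroup C] [NormedSpace 𝕜 C] [NormedAddCommGroup D] [NormedSpace 𝕜 D] {p : E}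

theorem fderiv_clm_apply₂ {S : E → A →L[𝕜] B →L[𝕜] C} {a : E → A} {b : E → B}
    (hS : DifferentiableAt 𝕜 S p) (ha : DifferentiableAt 𝕜 a p) (hb : DifferentiableAt 𝕜 b p)
    (q : E) : fderiv 𝕜 (fun z => S z (a z) (b z)) p q = fderiv 𝕜 S p q (a p) (b p)
      + S p (fderiv 𝕜 a p q) (b p) + S p (a p) (fderiv 𝕜 b p q) := by
  rw [fderiv_clm_apply (hS.clm_apply ha) hb, fderiv_clm_apply hS ha]
  simp only [add_apply, ContinuousLinearMap.comp_apply, ContinuousLinearMap.flip_apply]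
  abel

theorem fderiv_clm_apply_const₂ {S : E → A →L[𝕜] B →L[𝕜] C} (hS : DifferentiableAt 𝕜 S p)
    (a : A) (b : B) (q : E) : fderiv 𝕜 (fun z => S z a b) p q = fderiv 𝕜 S p q a b := by
  simp [fderiv_clm_apply₂ hS (differentiableAt_const a) (differentiableAt_const b)]

theorem fderiv_clm_apply_const₃ {S : E → A →L[𝕜] B →L[𝕜] C →L[𝕜] D}
    (hS : DifferentiableAt 𝕜 S p) (a : A) (b : B) (c : C) (q : E) :
    fderiv 𝕜 (fun z => S z a b c) p q = fderiv 𝕜 S p q a b c := by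
  simp [fderiv_clm_apply₂ (hS.clm_apply (differentiableAt_const a)) (differentiableAt_const b)
    (differentiableAt_const c), fderiv_clm_apply hS (differentiableAt_const a)]

theorem differentiableAt_fderiv_of_contDiffAt_two {f : E → A} (hf : ContDiffAt 𝕜 2 f p) :
    DifferentiableAt 𝕜 (fderiv 𝕜 f) p :=
  (hf.fderiv_right (m := 1) (by norm_num)).differentiableAt (by norm_num)

end BilinearCalculus

section TensorSymmetries

variable {α : Type*}

/-- The covariant 3-tensor `A` is totally skew-symmetric. -/
structure IsSkew₃ (A : α → α → α → ℝ) : Prop where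
  swap₁₂ : ∀ u v w, A u v w = -A v u w
  swap₂₃ : ∀ u v w, A u v w = -A u w v

namespace IsSkew₃

variable {A : α → α → α → ℝ}

theorem apply_self₁₂ (hA : IsSkew₃ A) (u v : α) : A u u v = 0 :=
  self_eq_neg.mp (hA.swap₁₂ u u v)

theorem swap₁₃ (hA : IsSkew₃ A) (u v w : α) : A u v w = -A w v u := by
  rw [hA.swap₁₂, hA.swap₂₃, hA.swap₁₂, neg_neg]

theorem apply_self₁₃ (hA : IsSkew₃ A) (u v : α) : A u v u = 0 :=
  self_eq_neg.mp (hA.swap₁₃ u v u)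

/-- Each of the three terms of the alternation contributes the same amount. -/
theorem sum_mul_alternation {ι : Type*} [Fintype ι] {T : ι → ι → ι → ℝ} (hT : IsSkew₃ T)
    (F : ι → ι → ι → ℝ) :
    ∑ a, ∑ b, ∑ d, T a b d * (F a b d - F b a d + F d a b) =
      3 * ∑ a, ∑ b, ∑ d, T a b d * F a b d := by
  have swap : ∑ a, ∑ b, ∑ d, T a b d * F b a d = -∑ a, ∑ b, ∑ d, T a b d * F a b d := by
    rw [Finset.sum_comm]
    simp only [← Finset.sum_neg_distrib]
    refine Finset.sum_congr rfl fun b _ => Finset.sum_congr rfl fun a _ =>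
      Finset.sum_congr rfl fun d _ => ?_
    rw [hT.swap₁₂, neg_mul]
  have rotate : ∑ a, ∑ b, ∑ d, T a b d * F d a b = ∑ a, ∑ b, ∑ d, T a b d * F a b d := by
    refine Finset.sum_comm_cycle.trans <| Finset.sum_congr rfl fun d _ =>
      Finset.sum_congr rfl fun a _ => Finset.sum_congr rfl fun b _ => ?_
    rw [hT.swap₂₃, hT.swap₁₂, neg_neg]
  simp only [mul_add, mul_sub, Finset.sum_add_distrib, Finset.sum_sub_distrib, swap, rotate]
  ring

end IsSkew₃

theorem eq_zero_of_symm₁₂_of_skew₂₃ {A : α → α → α → ℝ} (symm : ∀ u v w, A u v w = A v u w)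
    (skew : ∀ u v w, A u v w = -A u w v) (u v w : α) : A u v w = 0 := by
  linarith [symm u v w, skew v u w, symm v w u, skew w v u, symm w u v, skew u w v]

theorem pair_symm_of_cyclic {R : α → α → α → α → ℝ}
    (skew₁₂ : ∀ u v w t, R u v w t = -R v u w t) (skew₃₄ : ∀ u v w t, R u v w t = -R u v t w)
    (cyclic : ∀ u v w t, R u v w t + R v w u t + R w u v t = 0) (u v w t : α) :
    R u v w t = R w t u v := by
  linarith [cyclic u v w t, cyclic v w t u, cyclic w t u v, cyclic t u v w,
    skew₃₄ v w t u, skew₃₄ w t v u, skew₁₂ t v w u, skew₁₂ t u w v, skew₃₄ u t w v,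
    skew₁₂ u w t v, skew₃₄ w u t v, skew₁₂ t u v w, skew₃₄ u v t w, skew₃₄ v t u w]

/-- Antisymmetrizing in the first two arguments turns pair symmetry into skewness: this is how
`R ∈ S²Λ²` makes the covariant derivative of the torsion a 4-form. -/
theorem skew₁₂_of_isSkew₃_of_pair_symm {D : α → α → α → α → ℝ} (skew : ∀ u, IsSkew₃ (D u))
    (pair : ∀ u v w t, D u v w t - D v u w t = D w t u v - D t w u v) (u v w t : α) :
    D u v w t = -D v u w t := by
  have cyclic (u v w t : α) : D u v w t = -D t u v w := by
    linarith [pair u v w t, pair u w v t, (skew u).swap₂₃ v w t, (skew u).swap₁₂ v w t,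
      (skew v).swap₂₃ u w t, (skew v).swap₁₂ t u w, (skew v).swap₂₃ t u w, (skew w).swap₁₂ t u v,
      (skew w).swap₂₃ t u v, (skew w).swap₁₂ u t v, (skew t).swap₁₂ w u v,
      (skew t).swap₂₃ w u v, (skew t).swap₁₂ v u w, (skew t).swap₂₃ v u w,
      (skew t).swap₂₃ u v w, (skew w).swap₁₂ u v t, (skew w).swap₂₃ u v t]
  linarith [cyclic u v w t, cyclic v u w t, (skew t).swap₁₂ u v w]

end TensorSymmetries

section CoordinateCurvature

variable {E : Type*} [NormedAddCommGroup E] [NormedSpace ℝ E]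

/-- The curvature `R(u, v) w` at `p` of the connection `∂ + Γ` on a domain of a vector space. -/
noncomputable def coordCurvature (Γ : E → E →L[ℝ] E →L[ℝ] E) (p u v w : E) : E :=
  fderiv ℝ Γ p u v w - fderiv ℝ Γ p v u w + Γ p u (Γ p v w) - Γ p v (Γ p u w)

/-- The covariant derivative `(∇_w A)(u, v)` at `p` of a field of bilinear forms, for the
connection `∂ + S`. -/
noncomputable def coordCovDeriv₂ (S : E → E →L[ℝ] E →L[ℝ] E) (A : E → E → E → ℝ) (p w u v : E) :
    ℝ :=
  fderiv ℝ (fun z => A z u v) p w - A p (S p w u) v - A p u (S p w v)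

/-- The covariant derivative `(∇_w A)(u, v, t)` at `p` of a field of trilinear forms, for the
connection `∂ + S`. -/
noncomputable def coordCovDeriv₃ (S : E → E →L[ℝ] E →L[ℝ] E) (A : E → E → E → E → ℝ)
    (p w u v t : E) : ℝ :=
  fderiv ℝ (fun z => A z u v t) p w - A p (S p w u) v t - A p u (S p w v) t - A p u v (S p w t)

/-- The covariant derivative `(∇_w τ)(u, v)` at `p` of a field of vector-valued bilinear maps, for
the connection `∂ + S`. -/
noncomputable def coordCovDerivBilin (S τ : E → E →L[ℝ] E →L[ℝ] E) (p w u v : E) : E :=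
  fderiv ℝ τ p w u v + S p w (τ p u v) - τ p (S p w u) v - τ p u (S p w v)

/-- The covariant derivative `(∇_w R)(q, u) v` at `p` of the curvature `R` of `∂ + S`. -/
noncomputable def coordCovDerivCurvature (S : E → E →L[ℝ] E →L[ℝ] E) (p w q u v : E) : E :=
  fderiv ℝ (fun z => coordCurvature S z q u v) p w + S p w (coordCurvature S p q u v)
    - coordCurvature S p (S p w q) u v - coordCurvature S p q (S p w u) v
    - coordCurvature S p q u (S p w v)

/-- The covariant tensor `g(τ(u, v), w)`. -/
noncomputable def lowerIndex (g : E → E →L[ℝ] E →L[ℝ] ℝ) (τ : E → E →L[ℝ] E →L[ℝ] E)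
    (z u v w : E) : ℝ :=
  g z (τ z u v) w

/-- The exterior derivative at `p` of a 3-form on a domain of a vector space. -/
noncomputable def coordExtDeriv₃ (A : E → E → E → E → ℝ) (p u₀ u₁ u₂ u₃ : E) : ℝ :=
  fderiv ℝ (fun z => A z u₁ u₂ u₃) p u₀ - fderiv ℝ (fun z => A z u₀ u₂ u₃) p u₁
    + fderiv ℝ (fun z => A z u₀ u₁ u₃) p u₂ - fderiv ℝ (fun z => A z u₀ u₁ u₂) p u₃

/-- The Christoffel symbols of the metric connection with skew torsion `τ` whose Levi-Civita
connection has Christoffel symbols `S`. -/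
noncomputable def connectionWithTorsion (S τ : E → E →L[ℝ] E →L[ℝ] E) (z : E) : E →L[ℝ] E →L[ℝ] E :=
  S z + (1 / 2 : ℝ) • τ z

section Linearity

variable (Γ : E → E →L[ℝ] E →L[ℝ] E) (p u v w : E) (r : ℝ)

theorem coordCurvature_swap : coordCurvature Γ p u v w = -coordCurvature Γ p v u w := by
  simp only [coordCurvature]; abel

theorem coordCurvature_add₁ (u' : E) :
    coordCurvature Γ p (u + u') v w = coordCurvature Γ p u v w + coordCurvature Γ p u' v w := by
  simp only [coordCurvature, map_add, add_apply]; abel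

theorem coordCurvature_smul₁ :
    coordCurvature Γ p (r • u) v w = r • coordCurvature Γ p u v w := by
  simp only [coordCurvature, map_smul, smul_apply]; module

theorem coordCurvature_add₂ (v' : E) :
    coordCurvature Γ p u (v + v') w = coordCurvature Γ p u v w + coordCurvature Γ p u v' w := by
  simp only [coordCurvature, map_add, add_apply]; abel

theorem coordCurvature_smul₂ :
    coordCurvature Γ p u (r • v) w = r • coordCurvature Γ p u v w := by
  simp only [coordCurvature, map_smul, smul_apply]; module

theorem coordCurvature_add₃ (w' : E) :
    coordCurvature Γ p u v (w + w') = coordCurvature Γ p u v w + coordCurvature Γ p u v w' := by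
  simp only [coordCurvature, map_add]; abel

theorem coordCurvature_smul₃ :
    coordCurvature Γ p u v (r • w) = r • coordCurvature Γ p u v w := by
  simp only [coordCurvature, map_smul]; module

end Linearity

variable {S τ : E → E →L[ℝ] E →L[ℝ] E} {g : E → E →L[ℝ] E →L[ℝ] ℝ} {p : E}

theorem coordCurvature_congr {Γ Γ' : E → E →L[ℝ] E →L[ℝ] E} (h : Γ =ᶠ[𝓝 p] Γ') :
    coordCurvature Γ p = coordCurvature Γ' p := by
  ext u v w
  rw [coordCurvature, coordCurvature, h.fderiv_eq, h.self_of_nhds]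

theorem coordCurvature_connectionWithTorsion (hS : DifferentiableAt ℝ S p)
    (hτ : DifferentiableAt ℝ τ p) (symm : ∀ u v, S p u v = S p v u) (u v w : E) :
    coordCurvature (connectionWithTorsion S τ) p u v w =
      coordCurvature S p u v w + (1 / 2 : ℝ) • coordCovDerivBilin S τ p u v w
        - (1 / 2 : ℝ) • coordCovDerivBilin S τ p v u w
        + (1 / 4 : ℝ) • (τ p u (τ p v w) - τ p v (τ p u w)) := by
  have hd : fderiv ℝ (connectionWithTorsion S τ) p
      = fderiv ℝ S p + (1 / 2 : ℝ) • fderiv ℝ τ p :=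
    (hS.hasFDerivAt.fun_add (hτ.hasFDerivAt.fun_const_smul (1 / 2 : ℝ))).fderiv
  simp only [coordCurvature, coordCovDerivBilin, hd, connectionWithTorsion, add_apply, smul_apply,
    map_add, map_smul, symm v u]
  module

theorem differentiableAt_coordCurvature (hS : ContDiffAt ℝ 2 S p) (u v w : E) :
    DifferentiableAt ℝ (fun z => coordCurvature S z u v w) p := by
  have hS₁ : DifferentiableAt ℝ S p := hS.differentiableAt (by norm_num)
  have hS₂ := differentiableAt_fderiv_of_contDiffAt_two hS
  unfold coordCurvature
  fun_prop

theorem fderiv_coordCurvature (hS : ContDiffAt ℝ 2 S p) (u v w q : E) :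
    fderiv ℝ (fun z => coordCurvature S z u v w) p q =
      fderiv ℝ (fderiv ℝ S) p q u v w - fderiv ℝ (fderiv ℝ S) p q v u w
        + fderiv ℝ S p q u (S p v w) + S p u (fderiv ℝ S p q v w)
        - fderiv ℝ S p q v (S p u w) - S p v (fderiv ℝ S p q u w) := by
  have hS₁ : DifferentiableAt ℝ S p := hS.differentiableAt (by norm_num)
  have hS₂ := differentiableAt_fderiv_of_contDiffAt_two hS
  have fderiv_comp (u v w : E) : fderiv ℝ (fun z => S z u (S z v w)) p q =
      fderiv ℝ S p q u (S p v w) + S p u (fderiv ℝ S p q v w) := by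
    rw [fderiv_clm_apply₂ hS₁ (by fun_prop) (by fun_prop), fderiv_clm_apply_const₂ hS₁]
    simp
  unfold coordCurvature
  rw [fderiv_fun_sub (by fun_prop) (by fun_prop), fderiv_fun_add (by fun_prop) (by fun_prop),
    fderiv_fun_sub (by fun_prop) (by fun_prop)]
  simp only [sub_apply, add_apply, fderiv_clm_apply_const₃ hS₂, fderiv_comp]
  abel

theorem coordCurvature_cyclic (hS : DifferentiableAt ℝ S p)
    (symm : ∀ᶠ z in 𝓝 p, ∀ u v, S z u v = S z v u) (u v w : E) :
    coordCurvature S p u v w + coordCurvature S p v w u + coordCurvature S p w u v = 0 := by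
  have hs := symm.self_of_nhds
  have fderiv_symm : ∀ q a b, fderiv ℝ S p q a b = fderiv ℝ S p q b a := by
    intro q a b
    rw [← fderiv_clm_apply_const₂ hS, ← fderiv_clm_apply_const₂ hS,
      Filter.EventuallyEq.fderiv_eq (symm.mono fun z hz => hz a b)]
  simp only [coordCurvature]
  rw [fderiv_symm v w u, fderiv_symm u w v, fderiv_symm w v u, hs w u, hs v u, hs w v]
  abel

theorem coordCovDerivCurvature_cyclic (hS : ContDiffAt ℝ 2 S p)
    (symm : ∀ u v, S p u v = S p v u) (w q u v : E) :
    coordCovDerivCurvature S p w q u v + coordCovDerivCurvature S p q u w v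
      + coordCovDerivCurvature S p u w q v = 0 := by
  have schwarz : ∀ a b, fderiv ℝ (fderiv ℝ S) p a b = fderiv ℝ (fderiv ℝ S) p b a :=
    (hS.isSymmSndFDerivAt (by simp)).eq
  simp only [coordCovDerivCurvature, fderiv_coordCurvature hS]
  simp only [coordCurvature, map_add, map_sub]
  rw [schwarz q w, schwarz u w, schwarz u q, symm q w, symm u w, symm u q]
  abel

theorem coordCovDerivCurvature_swap (w q u v : E) :
    coordCovDerivCurvature S p w q u v = -coordCovDerivCurvature S p w u q v := by
  have swap : (fun z => coordCurvature S z q u v) = fun z => -coordCurvature S z u q v :=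
    funext fun z => coordCurvature_swap S z q u v
  simp only [coordCovDerivCurvature, swap, fderiv_fun_neg, neg_apply, coordCurvature_swap S p q,
    map_neg, coordCurvature_swap S p (S p w q)]
  abel

theorem isSkew₃_coordCovDeriv₃ {A : E → E → E → E → ℝ} (hA : ∀ᶠ z in 𝓝 p, IsSkew₃ (A z)) (w : E) :
    IsSkew₃ (coordCovDeriv₃ S A p w) := by
  have hp := hA.self_of_nhds
  constructor <;> intro u v t
  · have swap : (fun z => A z u v t) =ᶠ[𝓝 p] fun z => -A z v u t :=
      hA.mono fun z hz => hz.swap₁₂ u v t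
    simp only [coordCovDeriv₃, swap.fderiv_eq, fderiv_fun_neg, neg_apply]
    linarith [hp.swap₁₂ (S p w u) v t, hp.swap₁₂ u (S p w v) t, hp.swap₁₂ u v (S p w t)]
  · have swap : (fun z => A z u v t) =ᶠ[𝓝 p] fun z => -A z u t v :=
      hA.mono fun z hz => hz.swap₂₃ u v t
    simp only [coordCovDeriv₃, swap.fderiv_eq, fderiv_fun_neg, neg_apply]
    linarith [hp.swap₂₃ (S p w u) v t, hp.swap₂₃ u (S p w v) t, hp.swap₂₃ u v (S p w t)]

theorem coordExtDeriv₃_eq_alternation_covDeriv {A : E → E → E → E → ℝ} (hA : IsSkew₃ (A p))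
    (symm : ∀ u v, S p u v = S p v u) (w a b d : E) :
    coordExtDeriv₃ A p w a b d =
      coordCovDeriv₃ S A p w a b d - coordCovDeriv₃ S A p a w b d
        + coordCovDeriv₃ S A p b w a d - coordCovDeriv₃ S A p d w a b := by
  simp only [coordExtDeriv₃, coordCovDeriv₃]
  rw [symm a w, symm b w, symm d w, symm b a, symm d a, symm d b]
  linarith [hA.swap₁₂ a (S p w b) d, hA.swap₂₃ a b (S p w d), hA.swap₁₂ a (S p w d) b,
    hA.swap₁₂ w (S p a b) d, hA.swap₂₃ w b (S p a d), hA.swap₁₂ w (S p a d) b,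
    hA.swap₁₂ w (S p b d) a, hA.swap₂₃ w a (S p b d), hA.swap₁₂ (S p w a) b d,
    hA.swap₁₂ (S p w b) a d, hA.swap₁₂ (S p w d) a b, hA.swap₂₃ w (S p a d) b,
    hA.swap₂₃ w (S p b d) a]

/-- `S` are the Christoffel symbols, near `p`, of the Levi-Civita connection of the metric `g`;
nondegeneracy of `g` is not part of the definition. -/
structure IsLeviCivitaAt (g : E → E →L[ℝ] E →L[ℝ] ℝ) (S : E → E →L[ℝ] E →L[ℝ] E) (p : E) :
    Prop where
  contDiffAt_metric : ContDiffAt ℝ 2 g p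
  contDiffAt : ContDiffAt ℝ 2 S p
  symm_metric : ∀ᶠ z in 𝓝 p, ∀ u v, g z u v = g z v u
  symm : ∀ᶠ z in 𝓝 p, ∀ u v, S z u v = S z v u
  fderiv_metric : ∀ᶠ z in 𝓝 p, ∀ w u v, fderiv ℝ g z w u v = g z (S z w u) v + g z u (S z w v)

namespace IsLeviCivitaAt

theorem eventually (h : IsLeviCivitaAt g S p) : ∀ᶠ z in 𝓝 p, IsLeviCivitaAt g S z := by
  filter_upwards [h.contDiffAt_metric.eventually (by norm_num),
    h.contDiffAt.eventually (by norm_num), h.symm_metric.eventually_nhds,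
    h.symm.eventually_nhds, h.fderiv_metric.eventually_nhds] with z h₁ h₂ h₃ h₄ h₅
  exact ⟨h₁, h₂, h₃, h₄, h₅⟩

theorem differentiableAt_metric (h : IsLeviCivitaAt g S p) : DifferentiableAt ℝ g p :=
  h.contDiffAt_metric.differentiableAt (by norm_num)

theorem differentiableAt (h : IsLeviCivitaAt g S p) : DifferentiableAt ℝ S p :=
  h.contDiffAt.differentiableAt (by norm_num)

theorem fderiv_fderiv_metric (h : IsLeviCivitaAt g S p) (u v w t : E) :
    fderiv ℝ (fderiv ℝ g) p u v w t =
      fderiv ℝ g p u (S p v w) t + g p (fderiv ℝ S p u v w) t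
        + (fderiv ℝ g p u w (S p v t) + g p w (fderiv ℝ S p u v t)) := by
  have hg := h.differentiableAt_metric
  have hS := h.differentiableAt
  have metric : (fun z => fderiv ℝ g z v w t) =ᶠ[𝓝 p] fun z => g z (S z v w) t + g z w (S z v t) :=
    h.fderiv_metric.mono fun z hz => hz v w t
  rw [← fderiv_clm_apply_const₃ (differentiableAt_fderiv_of_contDiffAt_two h.contDiffAt_metric),
    metric.fderiv_eq, fderiv_fun_add (by fun_prop) (by fun_prop), add_apply,
    fderiv_clm_apply₂ hg (by fun_prop) (by fun_prop),
    fderiv_clm_apply₂ hg (by fun_prop) (by fun_prop)]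
  simp only [fderiv_clm_apply_const₂ hS, fderiv_fun_const, Pi.zero_apply, zero_apply, map_zero,
    add_zero]

theorem curvature_skew (h : IsLeviCivitaAt g S p) (u v w t : E) :
    g p (coordCurvature S p u v w) t = -g p (coordCurvature S p u v t) w := by
  have schwarz : fderiv ℝ (fderiv ℝ g) p u v w t = fderiv ℝ (fderiv ℝ g) p v u w t := by
    rw [(h.contDiffAt_metric.isSymmSndFDerivAt (by simp)).eq u v]
  simp only [h.fderiv_fderiv_metric, h.fderiv_metric.self_of_nhds] at schwarz
  rw [h.symm_metric.self_of_nhds _ w]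
  simp only [coordCurvature, map_add, map_sub, add_apply, sub_apply]
  linear_combination schwarz

theorem curvature_pair_symm (h : IsLeviCivitaAt g S p) (u v w t : E) :
    g p (coordCurvature S p u v w) t = g p (coordCurvature S p w t u) v := by
  refine pair_symm_of_cyclic (R := fun u v w t => g p (coordCurvature S p u v w) t)
    (fun u v w t => ?_) h.curvature_skew (fun u v w t => ?_) u v w t
  · rw [coordCurvature_swap, map_neg, neg_apply]
  · rw [← add_apply, ← map_add, ← add_apply, ← map_add,
      coordCurvature_cyclic h.differentiableAt h.symm, map_zero, zero_apply]

theorem inner_covDerivBilin (h : IsLeviCivitaAt g S p) (hτ : DifferentiableAt ℝ τ p)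
    (w u v t : E) : g p (coordCovDerivBilin S τ p w u v) t =
      coordCovDeriv₃ S (lowerIndex g τ) p w u v t := by
  unfold coordCovDeriv₃ lowerIndex
  rw [fderiv_clm_apply₂ h.differentiableAt_metric (by fun_prop) (by fun_prop),
    fderiv_clm_apply_const₂ hτ]
  simp only [coordCovDerivBilin, h.fderiv_metric.self_of_nhds, fderiv_fun_const, Pi.zero_apply,
    zero_apply, map_zero, map_add, map_sub, add_apply, sub_apply]
  ring

theorem inner_covDerivCurvature (h : IsLeviCivitaAt g S p) (w q u v t : E) :
    g p (coordCovDerivCurvature S p w q u v) t =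
      fderiv ℝ (fun z => g z (coordCurvature S z q u v) t) p w
        - g p (coordCurvature S p (S p w q) u v) t - g p (coordCurvature S p q (S p w u) v) t
        - g p (coordCurvature S p q u (S p w v)) t
        - g p (coordCurvature S p q u v) (S p w t) := by
  rw [fderiv_clm_apply₂ h.differentiableAt_metric
    (differentiableAt_coordCurvature h.contDiffAt q u v) (by fun_prop)]
  simp only [coordCovDerivCurvature, h.fderiv_metric.self_of_nhds, fderiv_fun_const,
    Pi.zero_apply, zero_apply, map_zero, map_add, map_sub, add_apply, sub_apply]
  ring

theorem covDerivCurvature_skew (h : IsLeviCivitaAt g S p) (w q u v t : E) :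
    g p (coordCovDerivCurvature S p w q u v) t =
      -g p (coordCovDerivCurvature S p w q u t) v := by
  have skew : (fun z => g z (coordCurvature S z q u v) t) =ᶠ[𝓝 p]
      fun z => -g z (coordCurvature S z q u t) v :=
    h.eventually.mono fun z hz => hz.curvature_skew q u v t
  simp only [h.inner_covDerivCurvature, skew.fderiv_eq, fderiv_fun_neg, neg_apply]
  linarith [h.curvature_skew (S p w q) u v t, h.curvature_skew q (S p w u) v t,
    h.curvature_skew q u (S p w v) t, h.curvature_skew q u v (S p w t)]

end IsLeviCivitaAt

end CoordinateCurvature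

section CoordinateTraces

variable {ι E : Type*} [Fintype ι] [NormedAddCommGroup E] [NormedSpace ℝ E]

/-- The Ricci tensor of the connection `∂ + Γ`, as a trace over the orthonormal frame `c`. -/
noncomputable def coordRicci (g : E → E →L[ℝ] E →L[ℝ] ℝ) (Γ : E → E →L[ℝ] E →L[ℝ] E)
    (c : E → ι → E) (z u v : E) : ℝ :=
  ∑ a, g z (coordCurvature Γ z (c z a) u v) (c z a)

/-- The scalar curvature of the connection `∂ + Γ`, as a trace over the orthonormal frame `c`. -/
noncomputable def coordScal (g : E → E →L[ℝ] E →L[ℝ] ℝ) (Γ : E → E →L[ℝ] E →L[ℝ] E)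
    (c : E → ι → E) (z : E) : ℝ :=
  ∑ i, coordRicci g Γ c z (c z i) (c z i)

/-- The tensor `T²` in the orthonormal frame `c`. -/
def coordTensorSq (T : E → E → E → E → ℝ) (c : E → ι → E) (z u v : E) : ℝ :=
  ∑ a, ∑ b, T z u (c z a) (c z b) * T z v (c z a) (c z b)

/-- The function `‖T‖²` in the orthonormal frame `c`. -/
def coordNormSq (T : E → E → E → E → ℝ) (c : E → ι → E) (z : E) : ℝ :=
  ∑ a, coordTensorSq T c z (c z a) (c z a)

variable {g : E → E →L[ℝ] E →L[ℝ] ℝ} {S τ : E → E →L[ℝ] E →L[ℝ] E} {c : E → ι → E} {p : E}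

theorem isBilinearMap_coordRicci (z : E) : IsBilinearMap ℝ (coordRicci g S c z) where
  add_left u v w := by
    simp only [coordRicci, coordCurvature_add₂, map_add, add_apply, Finset.sum_add_distrib]
  smul_left r u v := by
    simp only [coordRicci, coordCurvature_smul₂, map_smul, smul_apply, smul_eq_mul,
      Finset.mul_sum]
  add_right u v w := by
    simp only [coordRicci, coordCurvature_add₃, map_add, add_apply, Finset.sum_add_distrib]
  smul_right r u v := by
    simp only [coordRicci, coordCurvature_smul₃, map_smul, smul_apply, smul_eq_mul,
      Finset.mul_sum]

theorem isBilinearMap_coordTensorSq (z : E) :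
    IsBilinearMap ℝ (coordTensorSq (lowerIndex g τ) c z) where
  add_left u v w := by
    simp only [coordTensorSq, lowerIndex, map_add, add_apply, add_mul, Finset.sum_add_distrib]
  smul_left r u v := by
    simp only [coordTensorSq, lowerIndex, map_smul, smul_apply, smul_eq_mul, Finset.mul_sum,
      mul_assoc]
  add_right u v w := by
    simp only [coordTensorSq, lowerIndex, map_add, add_apply, mul_add, Finset.sum_add_distrib]
  smul_right r u v := by
    simp only [coordTensorSq, lowerIndex, map_smul, smul_apply, smul_eq_mul, Finset.mul_sum,
      mul_left_comm]

theorem coordScal_congr {Γ Γ' : E → E →L[ℝ] E →L[ℝ] E} (h : Γ =ᶠ[𝓝 p] Γ') :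
    coordScal g Γ c p = coordScal g Γ' c p := by
  simp only [coordScal, coordRicci, coordCurvature_congr h]

theorem coordRicci_symm (h : IsLeviCivitaAt g S p) (u v : E) :
    coordRicci g S c p u v = coordRicci g S c p v u := by
  refine Finset.sum_congr rfl fun a _ => ?_
  rw [h.curvature_pair_symm, coordCurvature_swap, map_neg, neg_apply, h.curvature_skew, neg_neg]

theorem coordCovDeriv₂_symm {A : E → E → E → ℝ} (hA : ∀ᶠ z in 𝓝 p, ∀ u v, A z u v = A z v u)
    (w u v : E) : coordCovDeriv₂ S A p w u v = coordCovDeriv₂ S A p w v u := by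
  have symm : (fun z => A z u v) =ᶠ[𝓝 p] fun z => A z v u := hA.mono fun z hz => hz u v
  simp only [coordCovDeriv₂, symm.fderiv_eq, hA.self_of_nhds _ v, hA.self_of_nhds u]
  ring

theorem coordCovDeriv₂_congr {A B : E → E → E → ℝ}
    (hAB : ∀ᶠ z in 𝓝 p, ∀ u v, A z u v = B z u v) (w u v : E) :
    coordCovDeriv₂ S A p w u v = coordCovDeriv₂ S B p w u v := by
  have eq_uv : (fun z => A z u v) =ᶠ[𝓝 p] fun z => B z u v := hAB.mono fun z hz => hz u v
  simp only [coordCovDeriv₂, eq_uv.fderiv_eq, hAB.self_of_nhds]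

theorem coordCovDeriv₂_mul_metric_add_mul (h : IsLeviCivitaAt g S p) {f : E → ℝ}
    {B : E → E → E → ℝ} (hf : DifferentiableAt ℝ f p)
    (hB : ∀ u v, DifferentiableAt ℝ (fun z => B z u v) p) (r : ℝ) (w u v : E) :
    coordCovDeriv₂ S (fun z u v => f z * g z u v + r * B z u v) p w u v =
      fderiv ℝ f p w * g p u v + r * coordCovDeriv₂ S B p w u v := by
  have hg := h.differentiableAt_metric
  have huv := hB u v
  simp only [coordCovDeriv₂]
  rw [fderiv_fun_add (by fun_prop) (by fun_prop), fderiv_fun_mul hf (by fun_prop),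
    fderiv_const_mul huv]
  simp only [add_apply, smul_apply, smul_eq_mul, fderiv_clm_apply_const₂ hg,
    h.fderiv_metric.self_of_nhds]
  ring

variable [DecidableEq ι]

/-- The frame `c` is orthonormal for the metric `g` near `p`; it may depend on the point in an
arbitrary, even discontinuous, way. -/
structure IsOrthonormalFrameAt (g : E → E →L[ℝ] E →L[ℝ] ℝ) (c : E → ι → E) (p : E) : Prop where
  finrank_eq : Module.finrank ℝ E = Fintype.card ι
  orthonormal : ∀ᶠ z in 𝓝 p, IsOrthonormalFor (g z).toBilinForm (c z)

namespace IsOrthonormalFrameAt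

theorem eventually (hc : IsOrthonormalFrameAt g c p) : ∀ᶠ z in 𝓝 p, IsOrthonormalFrameAt g c z :=
  hc.orthonormal.eventually_nhds.mono fun _ hz => ⟨hc.finrank_eq, hz⟩

variable [FiniteDimensional ℝ E]

theorem sum_apply_mul (hc : IsOrthonormalFrameAt g c p) (φ : E →ₗ[ℝ] ℝ) (u : E) :
    ∑ a, g p u (c p a) * φ (c p a) = φ u :=
  hc.orthonormal.self_of_nhds.sum_apply_mul hc.finrank_eq φ u

theorem sum_apply_mul_apply (hc : IsOrthonormalFrameAt g c p) (u v : E) :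
    ∑ a, g p u (c p a) * g p v (c p a) = g p u v := by
  rw [← ContinuousLinearMap.coe_coe (g p u), ← hc.sum_apply_mul _ v]
  exact Finset.sum_congr rfl fun a _ => mul_comm _ _

end IsOrthonormalFrameAt

variable [FiniteDimensional ℝ E]

theorem hasFDerivAt_trace (h : IsLeviCivitaAt g S p)
    (hc : IsOrthonormalFrameAt g c p) {A : E → E → E → ℝ}
    (hA : ∀ᶠ z in 𝓝 p, IsBilinearMap ℝ (A z))
    (hA' : ∀ u v, DifferentiableAt ℝ (fun z => A z u v) p) :
    HasFDerivAt (fun z => ∑ a, A z (c z a) (c z a))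
      (∑ i, fderiv ℝ (fun z => A z (c p i) (c p i)) p - ∑ i, ∑ j, A p (c p i) (c p j) •
        fderiv ℝ (fun z => g z (c p i) (c p j)) p) p := by
  have hg := h.differentiableAt_metric
  exact hasFDerivAt_orthonormal_trace (G := fun z => (g z).toBilinForm)
    (G' := fun u v => fderiv ℝ (fun z => g z u v) p) hc.finrank_eq
    (fun u v => (show DifferentiableAt ℝ (fun z => g z u v) p by fun_prop).hasFDerivAt)
    hc.orthonormal hA
    (fun u v => (hA' u v).hasFDerivAt)

theorem fderiv_trace (h : IsLeviCivitaAt g S p)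
    (hc : IsOrthonormalFrameAt g c p) {A : E → E → E → ℝ}
    (hA : ∀ᶠ z in 𝓝 p, IsBilinearMap ℝ (A z))
    (hA' : ∀ u v, DifferentiableAt ℝ (fun z => A z u v) p) (w : E) :
    fderiv ℝ (fun z => ∑ a, A z (c z a) (c z a)) p w =
      ∑ a, coordCovDeriv₂ S A p w (c p a) (c p a) := by
  have left (u v : E) : ∑ j, A p v (c p j) * g p u (c p j) = A p v u :=
    (Finset.sum_congr rfl fun _ _ => mul_comm _ _).trans
      (hc.sum_apply_mul (hA.self_of_nhds.toLinearMap v) u)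
  have right (u v : E) : ∑ i, A p (c p i) v * g p (c p i) u = A p u v :=
    (Finset.sum_congr rfl fun i _ => by
      rw [mul_comm, h.symm_metric.self_of_nhds]; rfl).trans
      (hc.sum_apply_mul (hA.self_of_nhds.toLinearMap.flip v) u)
  have correction : ∑ i, ∑ j, A p (c p i) (c p j) * fderiv ℝ g p w (c p i) (c p j) =
      ∑ i, (A p (S p w (c p i)) (c p i) + A p (c p i) (S p w (c p i))) := by
    simp only [h.fderiv_metric.self_of_nhds, mul_add, Finset.sum_add_distrib, left]
    rw [Finset.sum_comm, add_comm]
    simp only [right, add_comm]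
  rw [(hasFDerivAt_trace h hc hA hA').fderiv]
  simp only [sub_apply, sum_apply, smul_apply, smul_eq_mul,
    fderiv_clm_apply_const₂ h.differentiableAt_metric, correction, coordCovDeriv₂,
    Finset.sum_sub_distrib, Finset.sum_add_distrib]
  ring

end CoordinateTraces

section CoordinateBianchi

variable {ι E : Type*} [Fintype ι] [NormedAddCommGroup E] [NormedSpace ℝ E]
  {g : E → E →L[ℝ] E →L[ℝ] ℝ} {S τ : E → E →L[ℝ] E →L[ℝ] E} {c : E → ι → E} {p : E}

theorem isBilinearMap_inner_coordCurvature (z u v : E) :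
    IsBilinearMap ℝ fun q r => g z (coordCurvature S z q u v) r where
  add_left _ _ _ := by simp only [coordCurvature_add₁, map_add, add_apply]
  smul_left _ _ _ := by simp only [coordCurvature_smul₁, map_smul, smul_apply]
  add_right _ _ _ := map_add _ _ _
  smul_right _ _ _ := map_smul _ _ _

theorem differentiableAt_inner_coordCurvature (h : IsLeviCivitaAt g S p) (q u v r : E) :
    DifferentiableAt ℝ (fun z => g z (coordCurvature S z q u v) r) p := by
  have hg := h.differentiableAt_metric
  have hR := differentiableAt_coordCurvature h.contDiffAt q u v
  fun_prop

theorem differentiableAt_lowerIndex (h : IsLeviCivitaAt g S p) (hτ : DifferentiableAt ℝ τ p)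
    (u v w : E) : DifferentiableAt ℝ (fun z => lowerIndex g τ z u v w) p := by
  have hg := h.differentiableAt_metric
  unfold lowerIndex
  fun_prop

theorem isBilinearMap_sum_lowerIndex_mul (z u v : E) : IsBilinearMap ℝ fun q q' =>
    ∑ b, lowerIndex g τ z u q (c z b) * lowerIndex g τ z v q' (c z b) where
  add_left _ _ _ := by
    simp only [lowerIndex, map_add, add_apply, add_mul, Finset.sum_add_distrib]
  smul_left _ _ _ := by
    simp only [lowerIndex, map_smul, smul_apply, smul_eq_mul, mul_assoc, Finset.mul_sum]
  add_right _ _ _ := by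
    simp only [lowerIndex, map_add, add_apply, mul_add, Finset.sum_add_distrib]
  smul_right _ _ _ := by
    simp only [lowerIndex, map_smul, smul_apply, smul_eq_mul, mul_left_comm, Finset.mul_sum]

theorem isBilinearMap_lowerIndex_mul (z u v q q' : E) : IsBilinearMap ℝ fun r r' =>
    lowerIndex g τ z u q r * lowerIndex g τ z v q' r' where
  add_left _ _ _ := by simp only [lowerIndex, map_add, add_mul]
  smul_left _ _ _ := by simp only [lowerIndex, map_smul, smul_eq_mul, mul_assoc]
  add_right _ _ _ := by simp only [lowerIndex, map_add, mul_add]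
  smul_right _ _ _ := by simp only [lowerIndex, map_smul, smul_eq_mul, mul_left_comm]

theorem differentiableAt_lowerIndex_mul (h : IsLeviCivitaAt g S p) (hτ : DifferentiableAt ℝ τ p)
    (u v q q' r r' : E) :
    DifferentiableAt ℝ (fun z => lowerIndex g τ z u q r * lowerIndex g τ z v q' r') p :=
  (differentiableAt_lowerIndex h hτ _ _ _).mul (differentiableAt_lowerIndex h hτ _ _ _)

variable [DecidableEq ι] [FiniteDimensional ℝ E]

theorem differentiableAt_coordRicci (h : IsLeviCivitaAt g S p) (hc : IsOrthonormalFrameAt g c p)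
    (u v : E) : DifferentiableAt ℝ (fun z => coordRicci g S c z u v) p :=
  (hasFDerivAt_trace h hc (.of_forall fun z => isBilinearMap_inner_coordCurvature z u v)
    fun q r => differentiableAt_inner_coordCurvature h q u v r).differentiableAt

theorem coordCovDeriv₂_coordRicci (h : IsLeviCivitaAt g S p) (hc : IsOrthonormalFrameAt g c p)
    (w u v : E) : coordCovDeriv₂ S (coordRicci g S c) p w u v =
      ∑ a, g p (coordCovDerivCurvature S p w (c p a) u v) (c p a) := by
  have trace := fderiv_trace h hc
    (.of_forall fun z => isBilinearMap_inner_coordCurvature z u v)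
    (fun q r => differentiableAt_inner_coordCurvature h q u v r) w
  simp only [coordCovDeriv₂, coordRicci, trace, ← Finset.sum_sub_distrib,
    h.inner_covDerivCurvature]
  exact Finset.sum_congr rfl fun a _ => by ring

theorem differentiableAt_coordScal (h : IsLeviCivitaAt g S p) (hc : IsOrthonormalFrameAt g c p) :
    DifferentiableAt ℝ (coordScal g S c) p :=
  (hasFDerivAt_trace h hc (.of_forall isBilinearMap_coordRicci)
    (differentiableAt_coordRicci h hc)).differentiableAt

theorem fderiv_coordScal_eq_two_mul_div_coordRicci (h : IsLeviCivitaAt g S p)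
    (hc : IsOrthonormalFrameAt g c p) (w : E) :
    fderiv ℝ (coordScal g S c) p w =
      2 * ∑ i, coordCovDeriv₂ S (coordRicci g S c) p (c p i) (c p i) w := by
  have ricci_symm (i : ι) : coordCovDeriv₂ S (coordRicci g S c) p (c p i) (c p i) w =
      coordCovDeriv₂ S (coordRicci g S c) p (c p i) w (c p i) :=
    coordCovDeriv₂_symm (h.eventually.mono fun z hz => coordRicci_symm hz) _ _ _
  have bianchi (i a : ι) : g p (coordCovDerivCurvature S p w (c p a) (c p i) (c p i)) (c p a) =
      g p (coordCovDerivCurvature S p (c p a) (c p i) w (c p a)) (c p i)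
        + g p (coordCovDerivCurvature S p (c p i) (c p a) w (c p i)) (c p a) := by
    have cyclic := congrArg (fun x => g p x (c p a)) <|
      coordCovDerivCurvature_cyclic h.contDiffAt h.symm.self_of_nhds w (c p a) (c p i) (c p i)
    simp only [map_add, add_apply, map_zero, zero_apply] at cyclic
    rw [coordCovDerivCurvature_swap (c p i) w (c p a), map_neg, neg_apply,
      h.covDerivCurvature_skew (c p a) (c p i) w (c p i)] at cyclic
    linarith
  calc fderiv ℝ (coordScal g S c) p w
      = ∑ i, ∑ a, g p (coordCovDerivCurvature S p w (c p a) (c p i) (c p i)) (c p a) := by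
        refine (fderiv_trace h hc (.of_forall isBilinearMap_coordRicci)
          (differentiableAt_coordRicci h hc) w).trans ?_
        simp only [coordCovDeriv₂_coordRicci h hc]
    _ = 2 * ∑ i, coordCovDeriv₂ S (coordRicci g S c) p (c p i) (c p i) w := by
        simp only [bianchi, Finset.sum_add_distrib, ricci_symm, coordCovDeriv₂_coordRicci h hc]
        rw [Finset.sum_comm, two_mul]

theorem differentiableAt_sum_lowerIndex_mul (h : IsLeviCivitaAt g S p)
    (hc : IsOrthonormalFrameAt g c p) (hτ : DifferentiableAt ℝ τ p) (u v q q' : E) :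
    DifferentiableAt ℝ
      (fun z => ∑ b, lowerIndex g τ z u q (c z b) * lowerIndex g τ z v q' (c z b)) p :=
  (hasFDerivAt_trace h hc (.of_forall fun z => isBilinearMap_lowerIndex_mul z u v q q')
    (differentiableAt_lowerIndex_mul h hτ u v q q')).differentiableAt

theorem differentiableAt_coordTensorSq (h : IsLeviCivitaAt g S p)
    (hc : IsOrthonormalFrameAt g c p) (hτ : DifferentiableAt ℝ τ p) (u v : E) :
    DifferentiableAt ℝ (fun z => coordTensorSq (lowerIndex g τ) c z u v) p :=
  (hasFDerivAt_trace h hc (.of_forall fun z => isBilinearMap_sum_lowerIndex_mul z u v)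
    (differentiableAt_sum_lowerIndex_mul h hc hτ u v)).differentiableAt

theorem coordCovDeriv₂_coordTensorSq (h : IsLeviCivitaAt g S p)
    (hc : IsOrthonormalFrameAt g c p) (hτ : DifferentiableAt ℝ τ p) (w u v : E) :
    coordCovDeriv₂ S (coordTensorSq (lowerIndex g τ) c) p w u v =
      ∑ a, ∑ b, (coordCovDeriv₃ S (lowerIndex g τ) p w u (c p a) (c p b)
          * lowerIndex g τ p v (c p a) (c p b)
        + lowerIndex g τ p u (c p a) (c p b)
          * coordCovDeriv₃ S (lowerIndex g τ) p w v (c p a) (c p b)) := by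
  have trace := fderiv_trace h hc
    (.of_forall fun z => isBilinearMap_sum_lowerIndex_mul (g := g) (τ := τ) (c := c) z u v)
    (differentiableAt_sum_lowerIndex_mul h hc hτ u v) w
  have trace_inner (q q' : E) := fderiv_trace h hc
    (.of_forall fun z => isBilinearMap_lowerIndex_mul (g := g) (τ := τ) z u v q q')
    (differentiableAt_lowerIndex_mul h hτ u v q q') w
  have leibniz (q q' r r' : E) := fderiv_fun_mul (differentiableAt_lowerIndex h hτ u q r)
    (differentiableAt_lowerIndex h hτ v q' r')
  simp only [coordCovDeriv₂, coordTensorSq, trace, trace_inner, leibniz,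
    ← Finset.sum_sub_distrib]
  refine Finset.sum_congr rfl fun a _ => Finset.sum_congr rfl fun b _ => ?_
  simp only [coordCovDeriv₃, add_apply, smul_apply, smul_eq_mul]
  ring

theorem differentiableAt_coordNormSq (h : IsLeviCivitaAt g S p)
    (hc : IsOrthonormalFrameAt g c p) (hτ : DifferentiableAt ℝ τ p) :
    DifferentiableAt ℝ (coordNormSq (lowerIndex g τ) c) p :=
  (hasFDerivAt_trace h hc (.of_forall isBilinearMap_coordTensorSq)
    (differentiableAt_coordTensorSq h hc hτ)).differentiableAt

theorem fderiv_coordNormSq (h : IsLeviCivitaAt g S p) (hc : IsOrthonormalFrameAt g c p)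
    (hτ : DifferentiableAt ℝ τ p) (w : E) :
    fderiv ℝ (coordNormSq (lowerIndex g τ) c) p w =
      2 * ∑ i, ∑ a, ∑ b, lowerIndex g τ p (c p i) (c p a) (c p b)
        * coordCovDeriv₃ S (lowerIndex g τ) p w (c p i) (c p a) (c p b) := by
  refine (fderiv_trace h hc (.of_forall isBilinearMap_coordTensorSq)
    (differentiableAt_coordTensorSq h hc hτ) w).trans ?_
  simp only [coordCovDeriv₂_coordTensorSq h hc hτ, Finset.mul_sum]
  refine Finset.sum_congr rfl fun i _ => Finset.sum_congr rfl fun a _ =>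
    Finset.sum_congr rfl fun b _ => ?_
  ring

theorem sum_apply_mul_metric (h : IsLeviCivitaAt g S p) (hc : IsOrthonormalFrameAt g c p)
    (φ : E →L[ℝ] ℝ) (w : E) : ∑ i, φ (c p i) * g p (c p i) w = φ w :=
  (Finset.sum_congr rfl fun i _ => by rw [mul_comm, h.symm_metric.self_of_nhds]; rfl).trans
    (hc.sum_apply_mul φ.toLinearMap w)

end CoordinateBianchi

section CoordinateSkewTorsion

variable {ι E : Type*} [Fintype ι] [NormedAddCommGroup E] [NormedSpace ℝ E]
  {g : E → E →L[ℝ] E →L[ℝ] ℝ} {S τ : E → E →L[ℝ] E →L[ℝ] E} {c : E → ι → E} {p : E}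

/-- `S` is the Levi-Civita connection of `g` near `p` and `τ` is a torsion tensor whose lowering by
`g` is a 3-form. -/
structure IsSkewTorsionAt (g : E → E →L[ℝ] E →L[ℝ] ℝ) (S τ : E → E →L[ℝ] E →L[ℝ] E) (p : E) :
    Prop extends IsLeviCivitaAt g S p where
  differentiableAt_torsion : ∀ᶠ z in 𝓝 p, DifferentiableAt ℝ τ z
  isSkew₃ : ∀ᶠ z in 𝓝 p, IsSkew₃ (lowerIndex g τ z)

namespace IsSkewTorsionAt

theorem eventually_at (h : IsSkewTorsionAt g S τ p) : ∀ᶠ z in 𝓝 p, IsSkewTorsionAt g S τ z := by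
  filter_upwards [h.eventually, h.differentiableAt_torsion.eventually_nhds,
    h.isSkew₃.eventually_nhds] with z hS hτ skew
  exact ⟨hS, hτ, skew⟩

theorem inner_coordCurvature (h : IsSkewTorsionAt g S τ p) (u v w t : E) :
    g p (coordCurvature (connectionWithTorsion S τ) p u v w) t =
      g p (coordCurvature S p u v w) t + 1 / 2 * coordCovDeriv₃ S (lowerIndex g τ) p u v w t
        - 1 / 2 * coordCovDeriv₃ S (lowerIndex g τ) p v u w t
        + 1 / 4 * (g p (τ p v t) (τ p u w) - g p (τ p u t) (τ p v w)) := by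
  have hτ := h.differentiableAt_torsion.self_of_nhds
  have lower (u v w : E) : g p (τ p u v) w = -g p (τ p u w) v :=
    h.isSkew₃.self_of_nhds.swap₂₃ u v w
  rw [coordCurvature_connectionWithTorsion h.differentiableAt hτ h.symm.self_of_nhds]
  simp only [map_add, map_sub, map_smul, add_apply, sub_apply, smul_apply, smul_eq_mul,
    h.inner_covDerivBilin hτ, lower u (τ p v w) t, lower v (τ p u w) t]
  ring

theorem torsion_swap_inner (h : IsSkewTorsionAt g S τ p) (u v x : E) :
    g p (τ p u v) x = -g p (τ p v u) x :=
  h.isSkew₃.self_of_nhds.swap₁₂ u v x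

theorem coordCovDeriv₃_swap₁₂_of_pair_symm (h : IsSkewTorsionAt g S τ p)
    (pair_symm : ∀ u v w t, g p (coordCurvature (connectionWithTorsion S τ) p u v w) t =
      g p (coordCurvature (connectionWithTorsion S τ) p w t u) v) (u v w t : E) :
    coordCovDeriv₃ S (lowerIndex g τ) p u v w t = -coordCovDeriv₃ S (lowerIndex g τ) p v u w t := by
  have swap_swap (a b x y : E) : g p (τ p a b) (τ p x y) = g p (τ p b a) (τ p y x) := by
    rw [h.torsion_swap_inner a b, h.symm_metric.self_of_nhds, h.torsion_swap_inner x y, neg_neg,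
      h.symm_metric.self_of_nhds]
  refine skew₁₂_of_isSkew₃_of_pair_symm (isSkew₃_coordCovDeriv₃ h.isSkew₃)
    (fun u v w t => ?_) u v w t
  have pair := pair_symm u v w t
  rw [h.inner_coordCurvature, h.inner_coordCurvature, h.curvature_pair_symm u v w t,
    swap_swap t v w u, swap_swap w v t u, h.symm_metric.self_of_nhds (τ p v w)] at pair
  linarith

variable [DecidableEq ι] [FiniteDimensional ℝ E]

theorem coordRicci_eq (h : IsSkewTorsionAt g S τ p) (hc : IsOrthonormalFrameAt g c p) (u v : E) :
    coordRicci g (connectionWithTorsion S τ) c p u v =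
      coordRicci g S c p u v
        + 1 / 2 * ∑ a, coordCovDeriv₃ S (lowerIndex g τ) p (c p a) u v (c p a)
        - 1 / 4 * coordTensorSq (lowerIndex g τ) c p u v := by
  have skew := h.isSkew₃.self_of_nhds
  have torsion_sq (a : ι) : g p (τ p u (c p a)) (τ p (c p a) v) =
      -∑ b, lowerIndex g τ p u (c p a) (c p b) * lowerIndex g τ p v (c p a) (c p b) := by
    rw [← hc.sum_apply_mul_apply, ← Finset.sum_neg_distrib]
    refine Finset.sum_congr rfl fun b _ => ?_
    rw [h.torsion_swap_inner (c p a) v]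
    simp only [lowerIndex, mul_neg]
  simp only [coordRicci, coordTensorSq, h.inner_coordCurvature,
    (isSkew₃_coordCovDeriv₃ h.isSkew₃ _).apply_self₁₃, torsion_sq, Finset.mul_sum,
    ← Finset.sum_add_distrib, ← Finset.sum_sub_distrib]
  refine Finset.sum_congr rfl fun a _ => ?_
  have self (x : E) : g p (τ p (c p a) (c p a)) x = 0 := skew.apply_self₁₂ (c p a) x
  rw [self, ← Finset.mul_sum]
  ring

theorem coordRicci_add_swap (h : IsSkewTorsionAt g S τ p) (hc : IsOrthonormalFrameAt g c p)
    (u v : E) :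
    coordRicci g (connectionWithTorsion S τ) c p u v
      + coordRicci g (connectionWithTorsion S τ) c p v u =
    2 * coordRicci g S c p u v - 1 / 2 * coordTensorSq (lowerIndex g τ) c p u v := by
  have tensorSq_symm : coordTensorSq (lowerIndex g τ) c p v u =
      coordTensorSq (lowerIndex g τ) c p u v := by
    simp only [coordTensorSq, mul_comm]
  have skew : ∑ a, coordCovDeriv₃ S (lowerIndex g τ) p (c p a) u v (c p a) =
      -∑ a, coordCovDeriv₃ S (lowerIndex g τ) p (c p a) v u (c p a) := by
    rw [← Finset.sum_neg_distrib]
    exact Finset.sum_congr rfl fun a _ => (isSkew₃_coordCovDeriv₃ h.isSkew₃ _).swap₁₂ _ _ _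
  rw [h.coordRicci_eq hc, h.coordRicci_eq hc, tensorSq_symm, skew,
    coordRicci_symm h.toIsLeviCivitaAt v u]
  ring

theorem coordScal_leviCivita (h : IsSkewTorsionAt g S τ p) (hc : IsOrthonormalFrameAt g c p) :
    coordScal g S c p = coordScal g (connectionWithTorsion S τ) c p
      + 1 / 4 * coordNormSq (lowerIndex g τ) c p := by
  simp only [coordScal, coordNormSq, Finset.mul_sum, ← Finset.sum_add_distrib]
  refine Finset.sum_congr rfl fun i _ => ?_
  linarith [h.coordRicci_add_swap hc (c p i) (c p i)]

theorem hasFDerivAt_coordScal (h : IsSkewTorsionAt g S τ p) (hc : IsOrthonormalFrameAt g c p) :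
    HasFDerivAt (coordScal g (connectionWithTorsion S τ) c)
      (fderiv ℝ (coordScal g S c) p
        - (1 / 4 : ℝ) • fderiv ℝ (coordNormSq (lowerIndex g τ) c) p) p := by
  have hτ := h.differentiableAt_torsion.self_of_nhds
  have scal_eq : coordScal g (connectionWithTorsion S τ) c =ᶠ[𝓝 p]
      fun z => coordScal g S c z - 1 / 4 * coordNormSq (lowerIndex g τ) c z := by
    filter_upwards [h.eventually_at, hc.eventually] with z hz hcz
    rw [hz.coordScal_leviCivita hcz, add_sub_cancel_right]
  exact ((differentiableAt_coordScal h.toIsLeviCivitaAt hc).hasFDerivAt.fun_sub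
    ((differentiableAt_coordNormSq h.toIsLeviCivitaAt hc hτ).hasFDerivAt.const_mul
      (1 / 4 : ℝ))).congr_of_eventuallyEq scal_eq

theorem div_coordTensorSq (h : IsSkewTorsionAt g S τ p) (hc : IsOrthonormalFrameAt g c p) (w : E) :
    ∑ s, coordCovDeriv₂ S (coordTensorSq (lowerIndex g τ) c) p (c p s) (c p s) w =
      (∑ a, ∑ b, (∑ s, coordCovDeriv₃ S (lowerIndex g τ) p (c p s) (c p s) (c p a) (c p b))
        * lowerIndex g τ p w (c p a) (c p b))
      + ∑ s, ∑ a, ∑ b, lowerIndex g τ p (c p s) (c p a) (c p b)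
        * coordCovDeriv₃ S (lowerIndex g τ) p (c p s) w (c p a) (c p b) := by
  simp only [coordCovDeriv₂_coordTensorSq h.toIsLeviCivitaAt hc
    h.differentiableAt_torsion.self_of_nhds, Finset.sum_add_distrib, Finset.sum_mul]
  congr 1
  exact Finset.sum_comm_cycle.symm

theorem div_coordTensorSq_eq_extDeriv (h : IsSkewTorsionAt g S τ p)
    (hc : IsOrthonormalFrameAt g c p) (w : E) :
    ∑ s, coordCovDeriv₂ S (coordTensorSq (lowerIndex g τ) c) p (c p s) (c p s) w =
      (∑ a, ∑ b, (∑ s, coordCovDeriv₃ S (lowerIndex g τ) p (c p s) (c p s) (c p a) (c p b))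
        * lowerIndex g τ p w (c p a) (c p b))
      + 1 / 6 * fderiv ℝ (coordNormSq (lowerIndex g τ) c) p w
      - 1 / 3 * ∑ a, ∑ b, ∑ d, lowerIndex g τ p (c p a) (c p b) (c p d)
        * coordExtDeriv₃ (lowerIndex g τ) p w (c p a) (c p b) (c p d) := by
  have skew := h.isSkew₃.self_of_nhds
  have frame_skew : IsSkew₃ fun a b d => lowerIndex g τ p (c p a) (c p b) (c p d) :=
    ⟨fun _ _ _ => skew.swap₁₂ _ _ _, fun _ _ _ => skew.swap₂₃ _ _ _⟩
  have alternation := frame_skew.sum_mul_alternation fun a b d =>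
    coordCovDeriv₃ S (lowerIndex g τ) p (c p a) w (c p b) (c p d)
  have extDeriv : ∑ a, ∑ b, ∑ d, lowerIndex g τ p (c p a) (c p b) (c p d)
        * coordExtDeriv₃ (lowerIndex g τ) p w (c p a) (c p b) (c p d) =
      1 / 2 * fderiv ℝ (coordNormSq (lowerIndex g τ) c) p w
        - ∑ a, ∑ b, ∑ d, lowerIndex g τ p (c p a) (c p b) (c p d)
          * (coordCovDeriv₃ S (lowerIndex g τ) p (c p a) w (c p b) (c p d)
            - coordCovDeriv₃ S (lowerIndex g τ) p (c p b) w (c p a) (c p d)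
            + coordCovDeriv₃ S (lowerIndex g τ) p (c p d) w (c p a) (c p b)) := by
    rw [fderiv_coordNormSq h.toIsLeviCivitaAt hc h.differentiableAt_torsion.self_of_nhds,
      ← mul_assoc, one_div_mul_cancel two_ne_zero, one_mul]
    simp only [← Finset.sum_sub_distrib,
      coordExtDeriv₃_eq_alternation_covDeriv skew h.symm.self_of_nhds]
    refine Finset.sum_congr rfl fun a _ => Finset.sum_congr rfl fun b _ =>
      Finset.sum_congr rfl fun d _ => ?_
    ring
  rw [h.div_coordTensorSq hc, extDeriv, alternation]
  ring

theorem div_coordTensorSq_of_pair_symm (h : IsSkewTorsionAt g S τ p)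
    (hc : IsOrthonormalFrameAt g c p)
    (pair_symm : ∀ u v w t, g p (coordCurvature (connectionWithTorsion S τ) p u v w) t =
      g p (coordCurvature (connectionWithTorsion S τ) p w t u) v) (w : E) :
    ∑ s, coordCovDeriv₂ S (coordTensorSq (lowerIndex g τ) c) p (c p s) (c p s) w =
      -(1 / 2 * fderiv ℝ (coordNormSq (lowerIndex g τ) c) p w) := by
  have swap := h.coordCovDeriv₃_swap₁₂_of_pair_symm pair_symm
  have self (u v t : E) : coordCovDeriv₃ S (lowerIndex g τ) p u u v t = 0 :=
    self_eq_neg.mp (swap u u v t)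
  rw [h.div_coordTensorSq hc,
    fderiv_coordNormSq h.toIsLeviCivitaAt hc h.differentiableAt_torsion.self_of_nhds]
  simp only [self, swap _ w, Finset.sum_const_zero, zero_mul, mul_neg, Finset.sum_neg_distrib]
  ring

theorem coordRicci_eq_of_einstein [Nonempty ι] (h : IsSkewTorsionAt g S τ p)
    (hc : IsOrthonormalFrameAt g c p) {lam : ℝ}
    (einstein : ∀ u v, (coordRicci g (connectionWithTorsion S τ) c p u v
      + coordRicci g (connectionWithTorsion S τ) c p v u) / 2 = lam * g p u v) (u v : E) :
    coordRicci g S c p u v =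
      (Fintype.card ι : ℝ)⁻¹ * coordScal g (connectionWithTorsion S τ) c p * g p u v
        + 1 / 4 * coordTensorSq (lowerIndex g τ) c p u v := by
  have ricci_frame (i : ι) :
      coordRicci g (connectionWithTorsion S τ) c p (c p i) (c p i) = lam := by
    have unit : g p (c p i) (c p i) = 1 :=
      (hc.orthonormal.self_of_nhds i i).trans (if_pos rfl)
    linarith [unit ▸ einstein (c p i) (c p i)]
  have scal_eq : (Fintype.card ι : ℝ)⁻¹ * coordScal g (connectionWithTorsion S τ) c p = lam := by
    have card_ne_zero : (Fintype.card ι : ℝ) ≠ 0 := Nat.cast_ne_zero.mpr Fintype.card_ne_zero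
    simp only [coordScal, ricci_frame, Finset.sum_const, Finset.card_univ, nsmul_eq_mul]
    field_simp
  rw [scal_eq]
  linarith [h.coordRicci_add_swap hc u v, einstein u v]

theorem coordCovDeriv₂_coordRicci_of_einstein [Nonempty ι] (h : IsSkewTorsionAt g S τ p)
    (hc : IsOrthonormalFrameAt g c p)
    (einstein : ∀ᶠ z in 𝓝 p, ∃ lam : ℝ, ∀ u v,
      (coordRicci g (connectionWithTorsion S τ) c z u v
        + coordRicci g (connectionWithTorsion S τ) c z v u) / 2 = lam * g z u v) (w u v : E) :
    coordCovDeriv₂ S (coordRicci g S c) p w u v =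
      (Fintype.card ι : ℝ)⁻¹ * fderiv ℝ (coordScal g (connectionWithTorsion S τ) c) p w * g p u v
        + 1 / 4 * coordCovDeriv₂ S (coordTensorSq (lowerIndex g τ) c) p w u v := by
  have hScal := (h.hasFDerivAt_coordScal hc).differentiableAt
  have ricci_eq : ∀ᶠ z in 𝓝 p, ∀ u v, coordRicci g S c z u v =
      (Fintype.card ι : ℝ)⁻¹ * coordScal g (connectionWithTorsion S τ) c z * g z u v
        + 1 / 4 * coordTensorSq (lowerIndex g τ) c z u v := by
    filter_upwards [h.eventually_at, hc.eventually, einstein] with z hz hcz ⟨lam, hlam⟩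
    exact hz.coordRicci_eq_of_einstein hcz hlam
  rw [coordCovDeriv₂_congr ricci_eq, coordCovDeriv₂_mul_metric_add_mul h.toIsLeviCivitaAt
    (hScal.const_mul _) (differentiableAt_coordTensorSq h.toIsLeviCivitaAt hc
      h.differentiableAt_torsion.self_of_nhds), fderiv_const_mul hScal]
  rfl

theorem einstein_identity [Nonempty ι] (h : IsSkewTorsionAt g S τ p)
    (hc : IsOrthonormalFrameAt g c p)
    (einstein : ∀ᶠ z in 𝓝 p, ∃ lam : ℝ, ∀ u v,
      (coordRicci g (connectionWithTorsion S τ) c z u v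
        + coordRicci g (connectionWithTorsion S τ) c z v u) / 2 = lam * g z u v) (w : E) :
    ((Fintype.card ι : ℝ) - 2) / Fintype.card ι
        * fderiv ℝ (coordScal g (connectionWithTorsion S τ) c) p w
      - 1 / 2 * ∑ i, coordCovDeriv₂ S (coordTensorSq (lowerIndex g τ) c) p (c p i) (c p i) w
      + 1 / 4 * fderiv ℝ (coordNormSq (lowerIndex g τ) c) p w = 0 := by
  have bianchi := fderiv_coordScal_eq_two_mul_div_coordRicci h.toIsLeviCivitaAt hc w
  simp only [h.coordCovDeriv₂_coordRicci_of_einstein hc einstein, Finset.sum_add_distrib, mul_assoc,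
    ← Finset.mul_sum, sum_apply_mul_metric h.toIsLeviCivitaAt hc] at bianchi
  have fderiv_scal : fderiv ℝ (coordScal g (connectionWithTorsion S τ) c) p w =
      fderiv ℝ (coordScal g S c) p w
        - 1 / 4 * fderiv ℝ (coordNormSq (lowerIndex g τ) c) p w := by
    rw [(h.hasFDerivAt_coordScal hc).fderiv]
    rfl
  have card_ne_zero : (Fintype.card ι : ℝ) ≠ 0 := Nat.cast_ne_zero.mpr Fintype.card_ne_zero
  rw [sub_div, div_self card_ne_zero, div_eq_mul_inv]
  linear_combination bianchi + fderiv_scal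

end IsSkewTorsionAt

end CoordinateSkewTorsion

section Coordinates

variable {n : ℕ} {M : Type*} [TopologicalSpace M] [ChartedSpace (EuclideanSpace ℝ (Fin n)) M]
  {x y : M}

theorem extChartAt_symm_mem_source {z : EuclideanSpace ℝ (Fin n)}
    (hz : z ∈ (extChartAt (𝓡 n) x).target) :
    (extChartAt (𝓡 n) x).symm z ∈ (extChartAt (𝓡 n) x).source :=
  (extChartAt (𝓡 n) x).map_target hz

theorem eventually_mem_extChartAt_target (hy : y ∈ (extChartAt (𝓡 n) x).source) :
    ∀ᶠ z in 𝓝 (extChartAt (𝓡 n) x y), z ∈ (extChartAt (𝓡 n) x).target :=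
  (isOpen_extChartAt_target x).mem_nhds ((extChartAt (𝓡 n) x).map_source hy)

theorem eventually_exists_extChartAt_eq (x : M) : ∀ᶠ z in 𝓝 (extChartAt (𝓡 n) x x),
    ∃ y ∈ (extChartAt (𝓡 n) x).source, extChartAt (𝓡 n) x y = z := by
  filter_upwards [eventually_mem_extChartAt_target (mem_extChartAt_source (I := 𝓡 n) x)] with z hz
  exact ⟨_, extChartAt_symm_mem_source hz, (extChartAt (𝓡 n) x).right_inv hz⟩

theorem comp_extChartAt_symm_eventuallyEq {α : Type*} {f : M → α}
    {F : EuclideanSpace ℝ (Fin n) → α} (h : ∀ᶠ y in 𝓝 x, f y = F (extChartAt (𝓡 n) x y)) :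
    (fun z => f ((extChartAt (𝓡 n) x).symm z)) =ᶠ[𝓝 (extChartAt (𝓡 n) x x)] F := by
  have symm_tendsto := (continuousAt_extChartAt_symm (I := 𝓡 n) x).tendsto
  rw [(extChartAt (𝓡 n) x).left_inv (mem_extChartAt_source (I := 𝓡 n) x)] at symm_tendsto
  filter_upwards [symm_tendsto.eventually h,
    eventually_mem_extChartAt_target (mem_extChartAt_source (I := 𝓡 n) x)] with z hz hzt
  rw [hz, (extChartAt (𝓡 n) x).right_inv hzt]

variable [IsManifold (𝓡 n) ∞ M]

/-- The coordinates at `y` of a tangent vector, in the chart at `x`. -/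
noncomputable def coord (x y : M) : TangentSpace (𝓡 n) y →L[ℝ] EuclideanSpace ℝ (Fin n) :=
  (trivializationAt (EuclideanSpace ℝ (Fin n)) (fun x : M => TangentSpace (𝓡 n) x)
    x).continuousLinearMapAt ℝ y

/-- The tangent vector at `y` with given coordinates in the chart at `x`. -/
noncomputable def coordSymm (x y : M) : EuclideanSpace ℝ (Fin n) →L[ℝ] TangentSpace (𝓡 n) y :=
  (trivializationAt (EuclideanSpace ℝ (Fin n)) (fun x : M => TangentSpace (𝓡 n) x)
    x).symmL ℝ y

/-- The coordinate expression of a vector field in the chart at `x`. -/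
noncomputable def fieldInChart (x : M) (Y : Π y : M, TangentSpace (𝓡 n) y)
    (z : EuclideanSpace ℝ (Fin n)) : EuclideanSpace ℝ (Fin n) :=
  coord x ((extChartAt (𝓡 n) x).symm z) (Y ((extChartAt (𝓡 n) x).symm z))

/-- The vector field with constant coefficients in the chart at `x`. -/
noncomputable def constField (x : M) (u : EuclideanSpace ℝ (Fin n)) :
    Π y : M, TangentSpace (𝓡 n) y :=
  fun y => coordSymm x y u

theorem mem_baseSet_of_mem_source (hy : y ∈ (extChartAt (𝓡 n) x).source) :
    y ∈ (trivializationAt (EuclideanSpace ℝ (Fin n)) (fun x : M => TangentSpace (𝓡 n) x)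
      x).baseSet := by
  simpa using hy

theorem coord_coordSymm (hy : y ∈ (extChartAt (𝓡 n) x).source) (u : EuclideanSpace ℝ (Fin n)) :
    coord x y (coordSymm x y u) = u :=
  Bundle.Trivialization.continuousLinearMapAt_symmL _ (mem_baseSet_of_mem_source hy) u

theorem coordSymm_coord (hy : y ∈ (extChartAt (𝓡 n) x).source) (v : TangentSpace (𝓡 n) y) :
    coordSymm x y (coord x y v) = v :=
  Bundle.Trivialization.symmL_continuousLinearMapAt _ (mem_baseSet_of_mem_source hy) v

theorem ext_eq_constField (u : TangentSpace (𝓡 n) x) (hy : y ∈ (extChartAt (𝓡 n) x).source) :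
    ext u y = constField x (coord x x u) y := by
  have hx := mem_baseSet_of_mem_source (mem_extChartAt_source (I := 𝓡 n) x)
  rw [constField, coordSymm, coord, Bundle.Trivialization.continuousLinearMapAt_apply_of_mem _ _ hx,
    Bundle.Trivialization.symmL_apply _ (mem_baseSet_of_mem_source hy)]
  rfl

theorem mfderiv_extChartAt_eq_coord (hy : y ∈ (extChartAt (𝓡 n) x).source) :
    mfderiv (𝓡 n) 𝓘(ℝ, EuclideanSpace ℝ (Fin n)) (extChartAt (𝓡 n) x) y = coord x y :=
  (TangentBundle.continuousLinearMapAt_trivializationAt (by simpa using hy)).symm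

theorem mfderiv_extChartAt_symm_eq_coordSymm (hy : y ∈ (extChartAt (𝓡 n) x).source) :
    mfderiv 𝓘(ℝ, EuclideanSpace ℝ (Fin n)) (𝓡 n) (extChartAt (𝓡 n) x).symm
      (extChartAt (𝓡 n) x y) = coordSymm x y := by
  have h := TangentBundle.symmL_trivializationAt (I := 𝓡 n) (x₀ := x) (x := y) (by simpa using hy)
  rw [ModelWithCorners.Boundaryless.range_eq_univ, mfderivWithin_univ] at h
  exact h.symm

theorem contMDiffAt_extChartAt_symm (hy : y ∈ (extChartAt (𝓡 n) x).source) :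
    ContMDiffAt 𝓘(ℝ, EuclideanSpace ℝ (Fin n)) (𝓡 n) ∞ (extChartAt (𝓡 n) x).symm
      (extChartAt (𝓡 n) x y) :=
  (contMDiffOn_extChartAt_symm x).contMDiffAt (eventually_mem_extChartAt_target hy)

theorem hasMFDerivAt_extChartAt (hy : y ∈ (extChartAt (𝓡 n) x).source) :
    HasMFDerivAt (𝓡 n) 𝓘(ℝ, EuclideanSpace ℝ (Fin n)) (extChartAt (𝓡 n) x) y (coord x y) := by
  rw [← mfderiv_extChartAt_eq_coord hy]
  exact (mdifferentiableAt_extChartAt (by simpa using hy)).hasMFDerivAt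

theorem hasMFDerivAt_of_comp_extChartAt_symm {F : Type*} [NormedAddCommGroup F] [NormedSpace ℝ F]
    {f : M → F} {L : EuclideanSpace ℝ (Fin n) →L[ℝ] F} (hy : y ∈ (extChartAt (𝓡 n) x).source)
    (hf : HasFDerivAt (fun z => f ((extChartAt (𝓡 n) x).symm z)) L (extChartAt (𝓡 n) x y)) :
    HasMFDerivAt (𝓡 n) 𝓘(ℝ, F) f y (L ∘L coord x y) := by
  refine (HasMFDerivAt.comp y hf.hasMFDerivAt
    (hasMFDerivAt_extChartAt hy)).congr_of_eventuallyEq ?_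
  filter_upwards [extChartAt_source_mem_nhds' (I := 𝓡 n) hy] with y' hy'
  exact congrArg f ((extChartAt (𝓡 n) x).left_inv hy').symm

theorem mvfderiv_eq_of_comp_extChartAt_symm {f : M → ℝ} (hy : y ∈ (extChartAt (𝓡 n) x).source)
    (hf : DifferentiableAt ℝ (fun z => f ((extChartAt (𝓡 n) x).symm z)) (extChartAt (𝓡 n) x y))
    (v : TangentSpace (𝓡 n) y) :
    mvfderiv (𝓡 n) f y v =
      fderiv ℝ (fun z => f ((extChartAt (𝓡 n) x).symm z)) (extChartAt (𝓡 n) x y) (coord x y v) := by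
  rw [mvfderiv, (hasMFDerivAt_of_comp_extChartAt_symm hy hf.hasFDerivAt).mfderiv]
  rfl

theorem trivializationAt_snd_eventuallyEq_coord (hy : y ∈ (extChartAt (𝓡 n) x).source)
    (Y : Π y : M, TangentSpace (𝓡 n) y) :
    (fun y => (trivializationAt (EuclideanSpace ℝ (Fin n))
      (fun x : M => TangentSpace (𝓡 n) x) x ⟨y, Y y⟩).2) =ᶠ[𝓝 y] fun y => coord x y (Y y) := by
  filter_upwards [extChartAt_source_mem_nhds' (I := 𝓡 n) hy] with y' hy'
  rw [coord, Bundle.Trivialization.continuousLinearMapAt_apply_of_mem _ _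
    (mem_baseSet_of_mem_source hy')]

theorem mdifferentiableAt_iff_fieldInChart {Y : Π y : M, TangentSpace (𝓡 n) y}
    (hy : y ∈ (extChartAt (𝓡 n) x).source) :
    MDifferentiableAt (𝓡 n) ((𝓡 n).prod 𝓘(ℝ, EuclideanSpace ℝ (Fin n))) (T% Y) y ↔
      DifferentiableAt ℝ (fieldInChart x Y) (extChartAt (𝓡 n) x y) := by
  rw [Bundle.Trivialization.mdifferentiableAt_section_iff (𝓡 n)
    (trivializationAt (EuclideanSpace ℝ (Fin n)) (fun x : M => TangentSpace (𝓡 n) x) x) Y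
    (mem_baseSet_of_mem_source hy),
    (trivializationAt_snd_eventuallyEq_coord hy Y).mdifferentiableAt_iff]
  constructor <;> intro h
  · rw [← (extChartAt (𝓡 n) x).left_inv hy] at h
    exact (h.comp (extChartAt (𝓡 n) x y)
      ((contMDiffAt_extChartAt_symm hy).mdifferentiableAt (by simp))).differentiableAt
  · exact (hasMFDerivAt_of_comp_extChartAt_symm hy h.hasFDerivAt).mdifferentiableAt

theorem contDiffAt_fieldInChart {Y : Π y : M, TangentSpace (𝓡 n) y} {k : ℕ∞ω} (hk : k ≤ ∞)
    (hy : y ∈ (extChartAt (𝓡 n) x).source)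
    (hY : ContMDiffAt (𝓡 n) ((𝓡 n).prod 𝓘(ℝ, EuclideanSpace ℝ (Fin n))) k (T% Y) y) :
    ContDiffAt ℝ k (fieldInChart x Y) (extChartAt (𝓡 n) x y) := by
  have : IsManifold (𝓡 n) (k + 1) M := .of_le (n := ∞) (add_le_add_left hk 1)
  have : ContMDiffVectorBundle k (EuclideanSpace ℝ (Fin n))
      (fun x : M => TangentSpace (𝓡 n) x) (𝓡 n) := TangentBundle.contMDiffVectorBundle
  rw [Bundle.Trivialization.contMDiffAt_section_iff
    (trivializationAt (EuclideanSpace ℝ (Fin n)) (fun x : M => TangentSpace (𝓡 n) x) x)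
    (mem_baseSet_of_mem_source hy)] at hY
  have hcoord := hY.congr_of_eventuallyEq (trivializationAt_snd_eventuallyEq_coord hy Y).symm
  rw [← (extChartAt (𝓡 n) x).left_inv hy] at hcoord
  exact (hcoord.comp (extChartAt (𝓡 n) x y)
    ((contMDiffAt_extChartAt_symm hy).of_le hk)).contDiffAt

theorem fieldInChart_constField_eventuallyEq (hy : y ∈ (extChartAt (𝓡 n) x).source)
    (u : EuclideanSpace ℝ (Fin n)) :
    fieldInChart x (constField x u) =ᶠ[𝓝 (extChartAt (𝓡 n) x y)] fun _ => u := by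
  filter_upwards [eventually_mem_extChartAt_target hy] with z hz
  exact coord_coordSymm (extChartAt_symm_mem_source hz) u

theorem mdifferentiableAt_constField (hy : y ∈ (extChartAt (𝓡 n) x).source)
    (u : EuclideanSpace ℝ (Fin n)) :
    MDifferentiableAt (𝓡 n) ((𝓡 n).prod 𝓘(ℝ, EuclideanSpace ℝ (Fin n)))
      (T% (constField x u)) y := by
  rw [mdifferentiableAt_iff_fieldInChart hy]
  exact (differentiableAt_const u).congr_of_eventuallyEq (fieldInChart_constField_eventuallyEq hy u)

theorem inverse_mfderiv_extChartAt_symm (hy : y ∈ (extChartAt (𝓡 n) x).source) :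
    (mfderiv 𝓘(ℝ, EuclideanSpace ℝ (Fin n)) (𝓡 n) (extChartAt (𝓡 n) x).symm
      (extChartAt (𝓡 n) x y)).inverse = coord x y := by
  rw [mfderiv_extChartAt_symm_eq_coordSymm hy]
  exact ContinuousLinearMap.inverse_eq (ContinuousLinearMap.ext (coordSymm_coord hy))
    (ContinuousLinearMap.ext (coord_coordSymm hy))

theorem mpullback_extChartAt_symm_eventuallyEq (hy : y ∈ (extChartAt (𝓡 n) x).source)
    (Y : Π y : M, TangentSpace (𝓡 n) y) :
    VectorField.mpullback 𝓘(ℝ, EuclideanSpace ℝ (Fin n)) (𝓡 n) (extChartAt (𝓡 n) x).symm Y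
      =ᶠ[𝓝 (extChartAt (𝓡 n) x y)] fieldInChart x Y := by
  filter_upwards [eventually_mem_extChartAt_target hy] with z hz
  have inverse := inverse_mfderiv_extChartAt_symm (extChartAt_symm_mem_source hz)
  rw [(extChartAt (𝓡 n) x).right_inv hz] at inverse
  rw [VectorField.mpullback_apply, inverse]
  rfl

theorem mlieBracket_eq_lieBracket {V : Type*} [NormedAddCommGroup V] [NormedSpace ℝ V]
    (X Y : V → V) (z : V) :
    VectorField.mlieBracket 𝓘(ℝ, V) X Y z = VectorField.lieBracket ℝ X Y z :=
  (congrFun (VectorField.mlieBracketWithin_univ (I := 𝓘(ℝ, V)) (V := X) (W := Y)) z).symm.trans <|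
    (congrFun (VectorField.mlieBracketWithin_eq_lieBracketWithin (𝕜 := ℝ) (s := Set.univ)) z).trans
      (congrFun VectorField.lieBracketWithin_univ z)

theorem coord_mlieBracket {X Y : Π y : M, TangentSpace (𝓡 n) y}
    (hy : y ∈ (extChartAt (𝓡 n) x).source)
    (hX : DifferentiableAt ℝ (fieldInChart x X) (extChartAt (𝓡 n) x y))
    (hY : DifferentiableAt ℝ (fieldInChart x Y) (extChartAt (𝓡 n) x y)) :
    coord x y (VectorField.mlieBracket (𝓡 n) X Y y) =
      VectorField.lieBracket ℝ (fieldInChart x X) (fieldInChart x Y) (extChartAt (𝓡 n) x y) := by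
  have left_inv := (extChartAt (𝓡 n) x).left_inv hy
  have mdiff_X := (mdifferentiableAt_iff_fieldInChart hy).2 hX
  have mdiff_Y := (mdifferentiableAt_iff_fieldInChart hy).2 hY
  rw [← left_inv] at mdiff_X mdiff_Y
  have hle : minSmoothness ℝ 2 ≤ ∞ := by
    rw [minSmoothness_of_isRCLikeNormedField]
    exact WithTop.coe_le_coe.2 le_top
  have : IsManifold (𝓡 n) (minSmoothness ℝ 2) M := .of_le (n := ∞) hle
  have pullback := VectorField.mpullback_mlieBracket mdiff_X mdiff_Y
    (contMDiffAt_extChartAt_symm hy) hle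
  rw [(mpullback_extChartAt_symm_eventuallyEq hy X).mlieBracket_vectorField_eq
    (mpullback_extChartAt_symm_eventuallyEq hy Y),
    (mpullback_extChartAt_symm_eventuallyEq hy _).self_of_nhds, fieldInChart, left_inv] at pullback
  exact pullback.trans (mlieBracket_eq_lieBracket _ _ _)

end Coordinates

section Christoffel

variable {n : ℕ} {M : Type*} [TopologicalSpace M] [ChartedSpace (EuclideanSpace ℝ (Fin n)) M]
  [IsManifold (𝓡 n) ∞ M]

/-- The derivatives of the `k`-th coordinate vector field, in the chart at `x`. -/
noncomputable def christoffelColumn (nabla : Connection n M) (x : M)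
    (z : EuclideanSpace ℝ (Fin n)) (k : Fin n) :
    EuclideanSpace ℝ (Fin n) →L[ℝ] EuclideanSpace ℝ (Fin n) :=
  coord x ((extChartAt (𝓡 n) x).symm z) ∘L
    nabla (constField x (EuclideanSpace.single k 1)) ((extChartAt (𝓡 n) x).symm z) ∘L
    coordSymm x ((extChartAt (𝓡 n) x).symm z)

/-- The Christoffel symbols of a connection in the chart at `x`: the bilinear map `Γ` with
`∇ = ∂ + Γ`, whose first argument is the direction of differentiation. -/
noncomputable def christoffel (nabla : Connection n M) (x : M) (z : EuclideanSpace ℝ (Fin n)) :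
    EuclideanSpace ℝ (Fin n) →L[ℝ] EuclideanSpace ℝ (Fin n) →L[ℝ] EuclideanSpace ℝ (Fin n) :=
  (∑ k, (EuclideanSpace.proj k : EuclideanSpace ℝ (Fin n) →L[ℝ] ℝ).smulRight
    (christoffelColumn nabla x z k)).flip

variable {nabla : Connection n M} {x y : M} {X Y Z : Π y : M, TangentSpace (𝓡 n) y}

theorem christoffel_apply (z u w : EuclideanSpace ℝ (Fin n)) :
    christoffel nabla x z u w = ∑ k, w k • christoffelColumn nabla x z k u := by
  simp [christoffel]

theorem sum_smul_single (w : EuclideanSpace ℝ (Fin n)) :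
    ∑ k, w k • EuclideanSpace.single k (1 : ℝ) = w := by
  simpa using (EuclideanSpace.basisFun (Fin n) ℝ).sum_repr w

theorem constField_eq_sum (u : EuclideanSpace ℝ (Fin n)) :
    constField x u y = ∑ k, u k • constField x (EuclideanSpace.single k 1) y := by
  simp only [constField, ← map_smul, ← map_sum, sum_smul_single]

theorem connection_sum (s : Finset (Fin n)) (Y : Fin n → Π y : M, TangentSpace (𝓡 n) y)
    (hY : ∀ k, MDifferentiableAt (𝓡 n) ((𝓡 n).prod 𝓘(ℝ, EuclideanSpace ℝ (Fin n)))
      (T% (Y k)) y) :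
    nabla (fun y => ∑ k ∈ s, Y k y) y = ∑ k ∈ s, nabla (Y k) y := by
  classical
  induction s using Finset.induction_on with
  | empty => exact congrFun nabla.zero y
  | insert k s hk ih =>
    simp only [Finset.sum_insert hk, ← ih]
    exact nabla.isCovariantDerivativeOnUniv.add (hY k)
      (MDifferentiableAt.sum_section (s := s) fun i _ => hY i)

theorem hasFDerivAt_fieldInChart_apply
    (hY : DifferentiableAt ℝ (fieldInChart x Y) (extChartAt (𝓡 n) x y)) (k : Fin n) :
    HasFDerivAt (fun z => fieldInChart x Y z k)
      ((EuclideanSpace.proj k : EuclideanSpace ℝ (Fin n) →L[ℝ] ℝ) ∘L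
        fderiv ℝ (fieldInChart x Y) (extChartAt (𝓡 n) x y)) (extChartAt (𝓡 n) x y) :=
  (EuclideanSpace.proj k : EuclideanSpace ℝ (Fin n) →L[ℝ] ℝ).hasFDerivAt.comp _ hY.hasFDerivAt

theorem fieldInChart_extChartAt (hy : y ∈ (extChartAt (𝓡 n) x).source) :
    fieldInChart x Y (extChartAt (𝓡 n) x y) = coord x y (Y y) := by
  rw [fieldInChart, (extChartAt (𝓡 n) x).left_inv hy]

theorem coord_connection_smul_single (hy : y ∈ (extChartAt (𝓡 n) x).source) {f : M → ℝ}
    (hf : MDifferentiableAt (𝓡 n) 𝓘(ℝ, ℝ) f y) (k : Fin n) (v : TangentSpace (𝓡 n) y) :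
    coord x y (nabla (f • constField x (EuclideanSpace.single k 1)) y v) =
      mvfderiv (𝓡 n) f y v • EuclideanSpace.single k 1
        + f y • christoffelColumn nabla x (extChartAt (𝓡 n) x y) k (coord x y v) := by
  rw [nabla.isCovariantDerivativeOnUniv.leibniz (mdifferentiableAt_constField hy _) hf, add_apply,
    smul_apply, ContinuousLinearMap.smulRight_apply, map_add, map_smul, map_smul, constField,
    coord_coordSymm hy, christoffelColumn, (extChartAt (𝓡 n) x).left_inv hy, add_comm]
  simp only [ContinuousLinearMap.comp_apply, coordSymm_coord hy]

/-- Expand `Y` in the coordinate vector fields and use the Leibniz rule. -/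
theorem coord_connection (hy : y ∈ (extChartAt (𝓡 n) x).source)
    (hY : DifferentiableAt ℝ (fieldInChart x Y) (extChartAt (𝓡 n) x y))
    (v : TangentSpace (𝓡 n) y) :
    coord x y (nabla Y y v) =
      fderiv ℝ (fieldInChart x Y) (extChartAt (𝓡 n) x y) (coord x y v)
        + christoffel nabla x (extChartAt (𝓡 n) x y) (coord x y v)
          (fieldInChart x Y (extChartAt (𝓡 n) x y)) := by
  let f : Fin n → M → ℝ := fun k y => coord x y (Y y) k
  have f_deriv := hasFDerivAt_fieldInChart_apply hY
  have mdiff_f (k) : MDifferentiableAt (𝓡 n) 𝓘(ℝ, ℝ) (f k) y :=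
    (hasMFDerivAt_of_comp_extChartAt_symm hy (f_deriv k)).mdifferentiableAt
  have fderiv_f (k) : mvfderiv (𝓡 n) (f k) y v =
      fderiv ℝ (fieldInChart x Y) (extChartAt (𝓡 n) x y) (coord x y v) k := by
    rw [mvfderiv_eq_of_comp_extChartAt_symm hy (f_deriv k).differentiableAt]
    exact congrArg (· (coord x y v)) (f_deriv k).fderiv
  have mdiff_term (k) := (mdiff_f k).smul_section
    (mdifferentiableAt_constField hy (EuclideanSpace.single k (1 : ℝ)))
  have expansion : ∀ᶠ y' in 𝓝 y,
      Y y' = ∑ k, f k y' • constField x (EuclideanSpace.single k 1) y' := by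
    filter_upwards [extChartAt_source_mem_nhds' (I := 𝓡 n) hy] with y' hy'
    rw [← constField_eq_sum, constField, coordSymm_coord hy']
  rw [nabla.isCovariantDerivativeOnUniv.congr_of_eventuallyEq
    ((mdifferentiableAt_iff_fieldInChart hy).2 hY)
    (MDifferentiableAt.sum_section (s := Finset.univ) fun k _ => mdiff_term k) Filter.univ_mem
    expansion,
    connection_sum _ (fun k => f k • constField x (EuclideanSpace.single k 1)) mdiff_term,
    sum_apply, map_sum]
  simp only [coord_connection_smul_single hy (mdiff_f _), fderiv_f, Finset.sum_add_distrib,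
    sum_smul_single, christoffel_apply, fieldInChart_extChartAt hy, f]

theorem coord_connection_constField (hy : y ∈ (extChartAt (𝓡 n) x).source)
    (u : EuclideanSpace ℝ (Fin n)) (v : TangentSpace (𝓡 n) y) :
    coord x y (nabla (constField x u) y v) =
      christoffel nabla x (extChartAt (𝓡 n) x y) (coord x y v) u := by
  have h := fieldInChart_constField_eventuallyEq hy u
  rw [coord_connection hy ((differentiableAt_const u).congr_of_eventuallyEq h), h.fderiv_eq,
    h.self_of_nhds]
  simp

theorem fieldInChart_connection_eventuallyEq (hy : y ∈ (extChartAt (𝓡 n) x).source)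
    (hZ : ∀ᶠ z in 𝓝 (extChartAt (𝓡 n) x y), DifferentiableAt ℝ (fieldInChart x Z) z) :
    fieldInChart x (fun y => nabla Z y (Y y)) =ᶠ[𝓝 (extChartAt (𝓡 n) x y)] fun z =>
      fderiv ℝ (fieldInChart x Z) z (fieldInChart x Y z)
        + christoffel nabla x z (fieldInChart x Y z) (fieldInChart x Z z) := by
  filter_upwards [hZ, eventually_mem_extChartAt_target hy] with z hZz hz
  have right_inv := (extChartAt (𝓡 n) x).right_inv hz
  have h := coord_connection (nabla := nabla) (extChartAt_symm_mem_source hz) (by rwa [right_inv])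
    (Y ((extChartAt (𝓡 n) x).symm z))
  rw [right_inv] at h
  exact h

theorem coord_connection_connection (hy : y ∈ (extChartAt (𝓡 n) x).source)
    (hΓ : DifferentiableAt ℝ (christoffel nabla x) (extChartAt (𝓡 n) x y))
    (hY : DifferentiableAt ℝ (fieldInChart x Y) (extChartAt (𝓡 n) x y))
    (hZ : ContDiffAt ℝ 2 (fieldInChart x Z) (extChartAt (𝓡 n) x y)) {p u : EuclideanSpace ℝ (Fin n)}
    (hp : extChartAt (𝓡 n) x y = p) (v : TangentSpace (𝓡 n) y) (hu : coord x y v = u) :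
    coord x y (nabla (fun y => nabla Z y (Y y)) y v) =
      fderiv ℝ (fderiv ℝ (fieldInChart x Z)) p u (fieldInChart x Y p)
        + fderiv ℝ (fieldInChart x Z) p (fderiv ℝ (fieldInChart x Y) p u)
        + (fderiv ℝ (christoffel nabla x) p u (fieldInChart x Y p) (fieldInChart x Z p)
          + christoffel nabla x p (fderiv ℝ (fieldInChart x Y) p u) (fieldInChart x Z p)
          + christoffel nabla x p (fieldInChart x Y p) (fderiv ℝ (fieldInChart x Z) p u))
        + christoffel nabla x p u (fderiv ℝ (fieldInChart x Z) p (fieldInChart x Y p)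
          + christoffel nabla x p (fieldInChart x Y p) (fieldInChart x Z p)) := by
  have hZ₁ := hZ.differentiableAt (by norm_num)
  have hZ₂ := differentiableAt_fderiv_of_contDiffAt_two hZ
  have eq_in_chart := fieldInChart_connection_eventuallyEq (nabla := nabla) (Y := Y) hy
    ((hZ.eventually (by norm_num)).mono fun z hz => hz.differentiableAt (by norm_num))
  have diff₁ := hZ₂.clm_apply hY
  have diff₂ := (hΓ.clm_apply hY).clm_apply hZ₁
  rw [coord_connection hy ((diff₁.fun_add diff₂).congr_of_eventuallyEq eq_in_chart),
    eq_in_chart.fderiv_eq, eq_in_chart.self_of_nhds, fderiv_fun_add diff₁ diff₂, add_apply,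
    fderiv_clm_apply₂ hΓ hY hZ₁, (hZ₂.hasFDerivAt.clm_apply hY.hasFDerivAt).fderiv]
  subst hp hu
  simp only [add_apply, ContinuousLinearMap.comp_apply, ContinuousLinearMap.flip_apply]
  abel

theorem coord_curvatureField (hy : y ∈ (extChartAt (𝓡 n) x).source)
    (hΓ : DifferentiableAt ℝ (christoffel nabla x) (extChartAt (𝓡 n) x y))
    (hX : DifferentiableAt ℝ (fieldInChart x X) (extChartAt (𝓡 n) x y))
    (hY : DifferentiableAt ℝ (fieldInChart x Y) (extChartAt (𝓡 n) x y))
    (hZ : ContDiffAt ℝ 2 (fieldInChart x Z) (extChartAt (𝓡 n) x y)) :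
    coord x y (curvatureField nabla X Y Z y) =
      coordCurvature (christoffel nabla x) (extChartAt (𝓡 n) x y)
        (coord x y (X y)) (coord x y (Y y)) (coord x y (Z y)) := by
  have second_symm := (hZ.isSymmSndFDerivAt (by simp)).eq (coord x y (X y)) (coord x y (Y y))
  rw [curvatureField, map_sub, map_sub, coord_connection_connection hy hΓ hY hZ rfl _ rfl,
    coord_connection_connection hy hΓ hX hZ rfl _ rfl,
    coord_connection hy (hZ.differentiableAt (by norm_num)), coord_mlieBracket hy hX hY,
    VectorField.lieBracket, coordCurvature]
  simp only [fieldInChart_extChartAt hy, second_symm, map_add, map_sub, sub_apply]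
  abel

theorem contDiffAt_fieldInChart_ext (hy : y ∈ (extChartAt (𝓡 n) x).source)
    (u : TangentSpace (𝓡 n) y) :
    ContDiffAt ℝ 2 (fieldInChart x (ext u)) (extChartAt (𝓡 n) x y) :=
  contDiffAt_fieldInChart (WithTop.coe_le_coe.2 le_top) hy
    ((FiberBundle.contMDiffAt_extend (k := ∞) (𝓡 n) (EuclideanSpace ℝ (Fin n)) u).of_le
      (WithTop.coe_le_coe.2 le_top))

theorem ext_self (u : TangentSpace (𝓡 n) x) : ext u x = u :=
  FiberBundle.extend_apply_self (EuclideanSpace ℝ (Fin n)) u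

theorem coord_curvature (hy : y ∈ (extChartAt (𝓡 n) x).source)
    (hΓ : DifferentiableAt ℝ (christoffel nabla x) (extChartAt (𝓡 n) x y))
    (u v w : TangentSpace (𝓡 n) y) :
    coord x y (curvature nabla y u v w) =
      coordCurvature (christoffel nabla x) (extChartAt (𝓡 n) x y)
        (coord x y u) (coord x y v) (coord x y w) := by
  rw [curvature, coord_curvatureField hy hΓ
    ((contDiffAt_fieldInChart_ext hy u).differentiableAt (by norm_num))
    ((contDiffAt_fieldInChart_ext hy v).differentiableAt (by norm_num))
    (contDiffAt_fieldInChart_ext hy w), ext_self, ext_self, ext_self]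

theorem fieldInChart_ext_eventuallyEq (u : TangentSpace (𝓡 n) x) :
    fieldInChart x (ext u) =ᶠ[𝓝 (extChartAt (𝓡 n) x x)] fun _ => coord x x u := by
  filter_upwards [eventually_mem_extChartAt_target (mem_extChartAt_source (I := 𝓡 n) x)] with z hz
  rw [fieldInChart, ext_eq_constField _ (extChartAt_symm_mem_source hz), constField,
    coord_coordSymm (extChartAt_symm_mem_source hz)]

theorem coord_connection_ext (u v : TangentSpace (𝓡 n) x) :
    coord x x (nabla (ext u) x v)
      = christoffel nabla x (extChartAt (𝓡 n) x x) (coord x x v) (coord x x u) := by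
  have hx := mem_extChartAt_source (I := 𝓡 n) x
  rw [coord_connection hx ((contDiffAt_fieldInChart_ext hx u).differentiableAt (by norm_num)),
    (fieldInChart_ext_eventuallyEq u).fderiv_eq, fieldInChart_extChartAt hx, ext_self]
  simp

theorem mlieBracket_ext (u v : TangentSpace (𝓡 n) x) :
    VectorField.mlieBracket (𝓡 n) (ext u) (ext v) x = 0 := by
  have hx := mem_extChartAt_source (I := 𝓡 n) x
  have h := coord_mlieBracket hx ((contDiffAt_fieldInChart_ext hx u).differentiableAt (by norm_num))
    ((contDiffAt_fieldInChart_ext hx v).differentiableAt (by norm_num))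
  rw [VectorField.lieBracket, (fieldInChart_ext_eventuallyEq u).fderiv_eq,
    (fieldInChart_ext_eventuallyEq v).fderiv_eq] at h
  rw [← coordSymm_coord hx (VectorField.mlieBracket (𝓡 n) (ext u) (ext v) x), h]
  simp

theorem coord_mlieBracket_constField (hy : y ∈ (extChartAt (𝓡 n) x).source)
    (u v : EuclideanSpace ℝ (Fin n)) :
    coord x y (VectorField.mlieBracket (𝓡 n) (constField x u) (constField x v) y) = 0 := by
  have const (w) := fieldInChart_constField_eventuallyEq hy w
  have diff (w) := (mdifferentiableAt_iff_fieldInChart hy).1 (mdifferentiableAt_constField hy w)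
  rw [coord_mlieBracket hy (diff u) (diff v), VectorField.lieBracket, (const u).fderiv_eq,
    (const v).fderiv_eq]
  simp

theorem coord_torsion (hy : y ∈ (extChartAt (𝓡 n) x).source) (u v : TangentSpace (𝓡 n) y) :
    coord x y (nabla.torsion y u v) =
      christoffel nabla x (extChartAt (𝓡 n) x y) (coord x y u) (coord x y v)
        - christoffel nabla x (extChartAt (𝓡 n) x y) (coord x y v) (coord x y u) := by
  have h := nabla.torsion_apply (mdifferentiableAt_constField hy (coord x y u))
    (mdifferentiableAt_constField hy (coord x y v))
  rw [show constField x (coord x y u) y = u from coordSymm_coord hy u,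
    show constField x (coord x y v) y = v from coordSymm_coord hy v] at h
  rw [h, map_sub, map_sub, coord_connection_constField hy, coord_connection_constField hy,
    coord_mlieBracket_constField hy, sub_zero]

end Christoffel

section Smoothness

variable {n : ℕ} {M : Type*} [TopologicalSpace M] [ChartedSpace (EuclideanSpace ℝ (Fin n)) M]
  [IsManifold (𝓡 n) ∞ M] {nabla : Connection n M} {x y : M}

theorem contMDiffAt_constField (hy : y ∈ (extChartAt (𝓡 n) x).source)
    (u : EuclideanSpace ℝ (Fin n)) :
    ContMDiffAt (𝓡 n) ((𝓡 n).prod 𝓘(ℝ, EuclideanSpace ℝ (Fin n))) ∞ (T% (constField x u)) y := by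
  rw [Bundle.Trivialization.contMDiffAt_section_iff
    (trivializationAt (EuclideanSpace ℝ (Fin n)) (fun x : M => TangentSpace (𝓡 n) x) x)
    (mem_baseSet_of_mem_source hy)]
  refine (contMDiffAt_const (c := u)).congr_of_eventuallyEq
    ((trivializationAt_snd_eventuallyEq_coord hy _).trans ?_)
  filter_upwards [extChartAt_source_mem_nhds' (I := 𝓡 n) hy] with y' hy'
  exact coord_coordSymm hy' u

theorem connection_smul_of_eventually_eq_one (hy : y ∈ (extChartAt (𝓡 n) x).source) {ψ : M → ℝ}
    (hψ : ∀ᶠ y' in 𝓝 y, ψ y' = 1) (u : EuclideanSpace ℝ (Fin n)) :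
    nabla (ψ • constField x u) y = nabla (constField x u) y := by
  have eq : ∀ᶠ y' in 𝓝 y, constField x u y' = (ψ • constField x u) y' := by
    filter_upwards [hψ] with y' hy'
    rw [Pi.smul_apply', hy', one_smul]
  refine (nabla.isCovariantDerivativeOnUniv.congr_of_eventuallyEq
    (mdifferentiableAt_constField hy u)
    ((mdifferentiableAt_constField hy u).congr_of_eventuallyEq ?_) Filter.univ_mem eq).symm
  filter_upwards [eq] with y' hy'
  rw [hy']

/-- Smoothness of a connection is a statement about global vector fields, hence the cutoff `ψ`. -/
theorem contDiffAt_christoffelColumn [T2Space M] (h : nabla.ContMDiffCovariantDerivative ∞)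
    (k : Fin n) :
    ContDiffAt ℝ ∞ (fun z => christoffelColumn nabla x z k) (extChartAt (𝓡 n) x x) := by
  have hx := mem_extChartAt_source (I := 𝓡 n) x
  let ψ : SmoothBumpFunction (𝓡 n) x := Classical.arbitrary _
  let C := constField x (EuclideanSpace.single k (1 : ℝ))
  have smooth_cutoff : ContMDiff (𝓡 n) ((𝓡 n).prod 𝓘(ℝ, EuclideanSpace ℝ (Fin n))) ∞
      (T% ((ψ : M → ℝ) • C)) := by
    refine ContMDiffOn.smul_section_of_tsupport (u := (extChartAt (𝓡 n) x).source)
      ψ.contMDiff.contMDiffOn (isOpen_extChartAt_source x) ?_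
      fun y hy => (contMDiffAt_constField hy _).contMDiffWithinAt
    simpa only [extChartAt_source] using ψ.tsupport_subset_chartAt_source
  have smooth_nabla := (h.contMDiff.contMDiff smooth_cutoff.contMDiffOn).contMDiffAt (x := x)
    Filter.univ_mem
  rw [contMDiffAt_hom_bundle] at smooth_nabla
  have smooth_column : ContMDiffAt (𝓡 n)
      𝓘(ℝ, EuclideanSpace ℝ (Fin n) →L[ℝ] EuclideanSpace ℝ (Fin n)) ∞
      (fun y => coord x y ∘L nabla C y ∘L coordSymm x y) x := by
    refine smooth_nabla.2.congr_of_eventuallyEq ?_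
    filter_upwards [ψ.eventuallyEq_one.eventually_nhds,
      extChartAt_source_mem_nhds' (I := 𝓡 n) hx] with y hψ hy
    rw [← connection_smul_of_eventually_eq_one hy hψ]
    rfl
  exact contMDiffAt_iff_contDiffAt.1 (smooth_column.comp_of_eq (contMDiffAt_extChartAt_symm hx)
    ((extChartAt (𝓡 n) x).left_inv hx))

theorem contDiffAt_christoffel [T2Space M] (h : nabla.ContMDiffCovariantDerivative ∞) :
    ContDiffAt ℝ ∞ (christoffel nabla x) (extChartAt (𝓡 n) x x) := by
  have sum_column : ContDiffAt ℝ ∞ (fun z => ∑ k, (EuclideanSpace.proj k :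
      EuclideanSpace ℝ (Fin n) →L[ℝ] ℝ).smulRight (christoffelColumn nabla x z k))
      (extChartAt (𝓡 n) x x) :=
    .sum fun k _ => ContDiffAt.comp
      (g := ContinuousLinearMap.smulRightL ℝ _ _
        (EuclideanSpace.proj k : EuclideanSpace ℝ (Fin n) →L[ℝ] ℝ))
      (extChartAt (𝓡 n) x x) (ContinuousLinearMap.contDiff _).contDiffAt
      (contDiffAt_christoffelColumn h k)
  exact (ContinuousLinearMap.flipₗᵢ ℝ (EuclideanSpace ℝ (Fin n)) (EuclideanSpace ℝ (Fin n))
    (EuclideanSpace ℝ (Fin n))).contDiff.contDiffAt.comp (extChartAt (𝓡 n) x x) sum_column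

theorem eventually_differentiableAt_christoffel [T2Space M]
    (h : nabla.ContMDiffCovariantDerivative ∞) (x : M) :
    ∀ᶠ z in 𝓝 (extChartAt (𝓡 n) x x), DifferentiableAt ℝ (christoffel nabla x) z :=
  (((contDiffAt_christoffel h).of_le (WithTop.coe_le_coe.2 le_top) :
    ContDiffAt ℝ 1 _ _).eventually (by norm_num)).mono
      fun _ hz => hz.differentiableAt (by norm_num)

end Smoothness

section Metric

variable {n : ℕ} {M : Type*} [TopologicalSpace M] [ChartedSpace (EuclideanSpace ℝ (Fin n)) M]
  [IsManifold (𝓡 n) ∞ M]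
  [Bundle.RiemannianBundle (fun x : M => TangentSpace (𝓡 n) x)]

/-- The Riemannian metric in the chart at `x`. It is written out in coordinates so that its
smoothness reduces to that of its entries. -/
noncomputable def metricInChart (x : M) (z : EuclideanSpace ℝ (Fin n)) :
    EuclideanSpace ℝ (Fin n) →L[ℝ] EuclideanSpace ℝ (Fin n) →L[ℝ] ℝ :=
  ∑ i, ∑ j, (inner ℝ (constField x (EuclideanSpace.single i 1) ((extChartAt (𝓡 n) x).symm z))
    (constField x (EuclideanSpace.single j 1) ((extChartAt (𝓡 n) x).symm z)) : ℝ) •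
    (EuclideanSpace.proj i : EuclideanSpace ℝ (Fin n) →L[ℝ] ℝ).smulRight
      (EuclideanSpace.proj j : EuclideanSpace ℝ (Fin n) →L[ℝ] ℝ)

variable {x y : M}

theorem metricInChart_apply (z u v : EuclideanSpace ℝ (Fin n)) :
    metricInChart x z u v = inner ℝ (constField x u ((extChartAt (𝓡 n) x).symm z))
      (constField x v ((extChartAt (𝓡 n) x).symm z)) := by
  rw [constField_eq_sum u, constField_eq_sum v, sum_inner]
  simp only [inner_sum, inner_smul_left, inner_smul_right, metricInChart, sum_apply, smul_apply,
    ContinuousLinearMap.smulRight_apply, EuclideanSpace.coe_proj, smul_eq_mul, conj_trivial]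
  exact Finset.sum_congr rfl fun i _ => Finset.sum_congr rfl fun j _ => by ring

theorem metricInChart_comm (z u v : EuclideanSpace ℝ (Fin n)) :
    metricInChart x z u v = metricInChart x z v u := by
  rw [metricInChart_apply, metricInChart_apply, real_inner_comm]

theorem metricInChart_coord (hy : y ∈ (extChartAt (𝓡 n) x).source) (u v : TangentSpace (𝓡 n) y) :
    metricInChart x (extChartAt (𝓡 n) x y) (coord x y u) (coord x y v) = inner ℝ u v := by
  rw [metricInChart_apply, (extChartAt (𝓡 n) x).left_inv hy, constField, constField,
    coordSymm_coord hy, coordSymm_coord hy]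

theorem eq_zero_of_metricInChart_eq_zero (hy : y ∈ (extChartAt (𝓡 n) x).source)
    {u : EuclideanSpace ℝ (Fin n)} (h : ∀ v, metricInChart x (extChartAt (𝓡 n) x y) u v = 0) :
    u = 0 := by
  have inner_self := h u
  rw [← coord_coordSymm hy u, metricInChart_coord hy, inner_self_eq_zero] at inner_self
  rw [← coord_coordSymm hy u, inner_self, map_zero]

/-- The chosen orthonormal bases of the tangent spaces, in the chart at `x`. -/
noncomputable def frameInChart (x : M) (z : EuclideanSpace ℝ (Fin n)) (a : Fin n) :
    EuclideanSpace ℝ (Fin n) :=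
  coord x ((extChartAt (𝓡 n) x).symm z) (frame ((extChartAt (𝓡 n) x).symm z) a)

theorem frameInChart_extChartAt (hy : y ∈ (extChartAt (𝓡 n) x).source) (a : Fin n) :
    frameInChart x (extChartAt (𝓡 n) x y) a = coord x y (frame y a) := by
  rw [frameInChart, (extChartAt (𝓡 n) x).left_inv hy]

theorem isOrthonormalFrameAt_frameInChart (x : M) :
    IsOrthonormalFrameAt (metricInChart x) (frameInChart x) (extChartAt (𝓡 n) x x) where
  finrank_eq := by simp
  orthonormal := by
    filter_upwards [eventually_exists_extChartAt_eq x]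
    rintro _ ⟨y, hy, rfl⟩ a b
    rw [frameInChart_extChartAt hy, frameInChart_extChartAt hy]
    exact (metricInChart_coord hy _ _).trans (orthonormal_iff_ite.1 (frame y).orthonormal a b)

variable [IsContMDiffRiemannianBundle (𝓡 n) ∞ (EuclideanSpace ℝ (Fin n))
    (fun x : M => TangentSpace (𝓡 n) x)]

theorem contDiffAt_metricInChart : ContDiffAt ℝ ∞ (metricInChart x) (extChartAt (𝓡 n) x x) := by
  have hx := mem_extChartAt_source (I := 𝓡 n) x
  refine ContDiffAt.sum fun i _ => ContDiffAt.sum fun j _ => ContDiffAt.fun_smul ?_ contDiffAt_const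
  have smooth_entry :=
    ContMDiffAt.inner_bundle (contMDiffAt_constField hx (EuclideanSpace.single i (1 : ℝ)))
      (contMDiffAt_constField hx (EuclideanSpace.single j (1 : ℝ)))
  exact contMDiffAt_iff_contDiffAt.1 (smooth_entry.comp_of_eq (contMDiffAt_extChartAt_symm hx)
    ((extChartAt (𝓡 n) x).left_inv hx))

theorem eventually_differentiableAt_metricInChart :
    ∀ᶠ z in 𝓝 (extChartAt (𝓡 n) x x), DifferentiableAt ℝ (metricInChart x) z :=
  ((contDiffAt_metricInChart.of_le (WithTop.coe_le_coe.2 le_top) :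
    ContDiffAt ℝ 1 _ _).eventually (by norm_num)).mono
      fun _ hz => hz.differentiableAt (by norm_num)

theorem fderiv_metricInChart {nabla : Connection n M} (h : nabla.IsMetricCompatible)
    (hy : y ∈ (extChartAt (𝓡 n) x).source)
    (hg : DifferentiableAt ℝ (metricInChart x) (extChartAt (𝓡 n) x y))
    (w u v : EuclideanSpace ℝ (Fin n)) :
    fderiv ℝ (metricInChart x) (extChartAt (𝓡 n) x y) w u v =
      metricInChart x (extChartAt (𝓡 n) x y) (christoffel nabla x (extChartAt (𝓡 n) x y) w u) v
      + metricInChart x (extChartAt (𝓡 n) x y) u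
        (christoffel nabla x (extChartAt (𝓡 n) x y) w v) := by
  have metric := h.mvfderiv_inner_eq (constField x w) (mdifferentiableAt_constField hy u)
    (mdifferentiableAt_constField hy v)
  have inner_comp : (fun z => inner ℝ (constField x u ((extChartAt (𝓡 n) x).symm z))
      (constField x v ((extChartAt (𝓡 n) x).symm z))) = fun z => metricInChart x z u v :=
    funext fun z => (metricInChart_apply z u v).symm
  have differentiable : DifferentiableAt ℝ (fun z => metricInChart x z u v)
      (extChartAt (𝓡 n) x y) :=
    (hg.clm_apply (differentiableAt_const u)).clm_apply (differentiableAt_const v)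
  rw [mvfderiv_eq_of_comp_extChartAt_symm hy (by rwa [inner_comp]), inner_comp,
    fderiv_clm_apply_const₂ hg] at metric
  beta_reduce at metric
  rw [← metricInChart_coord hy, ← metricInChart_coord hy, coord_connection_constField hy,
    coord_connection_constField hy] at metric
  simpa only [constField, coord_coordSymm hy] using metric

end Metric

section Torsion

variable {n : ℕ} {M : Type*} [TopologicalSpace M] [ChartedSpace (EuclideanSpace ℝ (Fin n)) M]
  [IsManifold (𝓡 n) ∞ M]

/-- The symmetric part of the Christoffel symbols. When the torsion is skew-symmetric, these are
the Christoffel symbols of the Levi-Civita connection. -/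
noncomputable def christoffelSymm (nabla : Connection n M) (x : M)
    (z : EuclideanSpace ℝ (Fin n)) :
    EuclideanSpace ℝ (Fin n) →L[ℝ] EuclideanSpace ℝ (Fin n) →L[ℝ] EuclideanSpace ℝ (Fin n) :=
  (1 / 2 : ℝ) • (christoffel nabla x z + (christoffel nabla x z).flip)

/-- The torsion of a connection in the chart at `x`. -/
noncomputable def christoffelTorsion (nabla : Connection n M) (x : M)
    (z : EuclideanSpace ℝ (Fin n)) :
    EuclideanSpace ℝ (Fin n) →L[ℝ] EuclideanSpace ℝ (Fin n) →L[ℝ] EuclideanSpace ℝ (Fin n) :=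
  christoffel nabla x z - (christoffel nabla x z).flip

variable {nabla nablaG : Connection n M} {x y : M}

theorem connectionWithTorsion_christoffel (nabla : Connection n M) (x : M) :
    connectionWithTorsion (christoffelSymm nabla x) (christoffelTorsion nabla x) =
      christoffel nabla x := by
  funext z
  rw [connectionWithTorsion, christoffelSymm, christoffelTorsion]
  module

theorem christoffelSymm_comm (z u v : EuclideanSpace ℝ (Fin n)) :
    christoffelSymm nabla x z u v = christoffelSymm nabla x z v u := by
  simp [christoffelSymm, add_comm]

theorem christoffel_comm_of_torsion_eq_zero (h : nablaG.torsion = 0)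
    (hy : y ∈ (extChartAt (𝓡 n) x).source) (u v : EuclideanSpace ℝ (Fin n)) :
    christoffel nablaG x (extChartAt (𝓡 n) x y) u v =
      christoffel nablaG x (extChartAt (𝓡 n) x y) v u := by
  have torsion_eq := coord_torsion (nabla := nablaG) hy (coordSymm x y u) (coordSymm x y v)
  have torsion_zero : nablaG.torsion y (coordSymm x y u) (coordSymm x y v) = 0 := by
    rw [h]
    rfl
  rw [torsion_zero, map_zero, coord_coordSymm hy, coord_coordSymm hy] at torsion_eq
  exact sub_eq_zero.1 torsion_eq.symm

theorem contDiffAt_flip_christoffel [T2Space M] (h : nabla.ContMDiffCovariantDerivative ∞) :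
    ContDiffAt ℝ ∞ (fun z => (christoffel nabla x z).flip) (extChartAt (𝓡 n) x x) :=
  (ContinuousLinearMap.flipₗᵢ ℝ (EuclideanSpace ℝ (Fin n)) (EuclideanSpace ℝ (Fin n))
    (EuclideanSpace ℝ (Fin n))).contDiff.contDiffAt.comp (extChartAt (𝓡 n) x x)
      (contDiffAt_christoffel h)

theorem contDiffAt_christoffelSymm [T2Space M] (h : nabla.ContMDiffCovariantDerivative ∞) :
    ContDiffAt ℝ ∞ (christoffelSymm nabla x) (extChartAt (𝓡 n) x x) :=
  ((contDiffAt_christoffel h).add (contDiffAt_flip_christoffel h)).const_smul _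

theorem contDiffAt_christoffelTorsion [T2Space M] (h : nabla.ContMDiffCovariantDerivative ∞) :
    ContDiffAt ℝ ∞ (christoffelTorsion nabla x) (extChartAt (𝓡 n) x x) :=
  (contDiffAt_christoffel h).sub (contDiffAt_flip_christoffel h)

variable [Bundle.RiemannianBundle (fun x : M => TangentSpace (𝓡 n) x)]

theorem torsionForm_eq_lowerIndex (hy : y ∈ (extChartAt (𝓡 n) x).source)
    (u v w : TangentSpace (𝓡 n) y) :
    torsionForm nabla y u v w =
      lowerIndex (metricInChart x) (christoffelTorsion nabla x) (extChartAt (𝓡 n) x y)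
        (coord x y u) (coord x y v) (coord x y w) := by
  rw [torsionForm, ← metricInChart_coord hy, coord_torsion hy]
  rfl

variable [IsContMDiffRiemannianBundle (𝓡 n) ∞ (EuclideanSpace ℝ (Fin n))
    (fun x : M => TangentSpace (𝓡 n) x)]

theorem isSkew₃_lowerIndex_christoffelTorsion (h : IsMetricWithSkewTorsion nabla)
    (hy : y ∈ (extChartAt (𝓡 n) x).source) :
    IsSkew₃ (lowerIndex (metricInChart x) (christoffelTorsion nabla x) (extChartAt (𝓡 n) x y)) := by
  have eq_torsionForm : ∀ u v w,
      lowerIndex (metricInChart x) (christoffelTorsion nabla x) (extChartAt (𝓡 n) x y) u v w =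
        torsionForm nabla y (coordSymm x y u) (coordSymm x y v) (coordSymm x y w) := by
    intro u v w
    rw [torsionForm_eq_lowerIndex hy, coord_coordSymm hy, coord_coordSymm hy, coord_coordSymm hy]
  constructor <;> intro u v w <;> rw [eq_torsionForm, eq_torsionForm]
  exacts [h.skew₁₂ _ _ _ _, h.skew₂₃ _ _ _ _]

theorem fderiv_metricInChart_christoffelSymm (h : IsMetricWithSkewTorsion nabla)
    (hy : y ∈ (extChartAt (𝓡 n) x).source)
    (hg : DifferentiableAt ℝ (metricInChart x) (extChartAt (𝓡 n) x y))
    (w u v : EuclideanSpace ℝ (Fin n)) :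
    fderiv ℝ (metricInChart x) (extChartAt (𝓡 n) x y) w u v =
      metricInChart x (extChartAt (𝓡 n) x y)
        (christoffelSymm nabla x (extChartAt (𝓡 n) x y) w u) v
      + metricInChart x (extChartAt (𝓡 n) x y) u
        (christoffelSymm nabla x (extChartAt (𝓡 n) x y) w v) := by
  have skew := (isSkew₃_lowerIndex_christoffelTorsion h hy).swap₂₃ w u v
  rw [lowerIndex, lowerIndex, metricInChart_comm _ _ u] at skew
  rw [fderiv_metricInChart h.metric hy hg, ← connectionWithTorsion_christoffel]
  simp only [connectionWithTorsion, add_apply, smul_apply, map_add, map_smul, smul_eq_mul]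
  linarith

theorem isSkewTorsionAt_christoffel [T2Space M] (h : IsMetricWithSkewTorsion nabla) (x : M) :
    IsSkewTorsionAt (metricInChart x) (christoffelSymm nabla x) (christoffelTorsion nabla x)
      (extChartAt (𝓡 n) x x) where
  contDiffAt_metric := contDiffAt_metricInChart.of_le (WithTop.coe_le_coe.2 le_top)
  contDiffAt := (contDiffAt_christoffelSymm h.smooth).of_le (WithTop.coe_le_coe.2 le_top)
  symm_metric := .of_forall metricInChart_comm
  symm := .of_forall christoffelSymm_comm
  fderiv_metric := by
    filter_upwards [eventually_exists_extChartAt_eq x, eventually_differentiableAt_metricInChart]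
    rintro _ ⟨y, hy, rfl⟩ hg
    exact fderiv_metricInChart_christoffelSymm h hy hg
  differentiableAt_torsion :=
    (((contDiffAt_christoffelTorsion h.smooth).of_le (WithTop.coe_le_coe.2 le_top) :
      ContDiffAt ℝ 1 _ _).eventually (by norm_num)).mono
        fun _ hz => hz.differentiableAt (by norm_num)
  isSkew₃ := by
    filter_upwards [eventually_exists_extChartAt_eq x]
    rintro _ ⟨y, hy, rfl⟩
    exact isSkew₃_lowerIndex_christoffelTorsion h hy

theorem christoffel_eventuallyEq_christoffelSymm (h : IsMetricWithSkewTorsion nabla)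
    (hG : IsLeviCivita nablaG) (x : M) :
    christoffel nablaG x =ᶠ[𝓝 (extChartAt (𝓡 n) x x)] christoffelSymm nabla x := by
  filter_upwards [eventually_exists_extChartAt_eq x, eventually_differentiableAt_metricInChart]
  rintro _ ⟨y, hy, rfl⟩ hg
  ext1 u
  ext1 v
  refine sub_eq_zero.1 (eq_zero_of_metricInChart_eq_zero hy fun w => ?_)
  refine eq_zero_of_symm₁₂_of_skew₂₃ (A := fun u v w => metricInChart x (extChartAt (𝓡 n) x y)
    (christoffel nablaG x (extChartAt (𝓡 n) x y) u v -
      christoffelSymm nabla x (extChartAt (𝓡 n) x y) u v) w) (fun u v w => ?_)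
    (fun u v w => ?_) u v w
  · rw [christoffel_comm_of_torsion_eq_zero hG.torsion_eq_zero hy u v, christoffelSymm_comm _ u v]
  · have metric_eq := (fderiv_metricInChart hG.metric hy hg u v w).symm.trans
      (fderiv_metricInChart_christoffelSymm h hy hg u v w)
    rw [metricInChart_comm _ v, metricInChart_comm _ v] at metric_eq
    simp only [map_sub, sub_apply]
    linarith

end Torsion

section CoordinateExpressions

variable {n : ℕ} {M : Type*} [TopologicalSpace M] [ChartedSpace (EuclideanSpace ℝ (Fin n)) M]
  [IsManifold (𝓡 n) ∞ M]

/-- `A` is the expression, in the chart at `x`, of the covariant 2-tensor field `B`. -/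
def IsCoordExpr₂ (x : M) (B : Π y : M, TangentSpace (𝓡 n) y → TangentSpace (𝓡 n) y → ℝ)
    (A : EuclideanSpace ℝ (Fin n) → EuclideanSpace ℝ (Fin n) → EuclideanSpace ℝ (Fin n) → ℝ) :
    Prop :=
  ∀ y ∈ (extChartAt (𝓡 n) x).source, ∀ u v : TangentSpace (𝓡 n) y,
    B y u v = A (extChartAt (𝓡 n) x y) (coord x y u) (coord x y v)

/-- `A` is the expression, in the chart at `x`, of the covariant 3-tensor field `B`. -/
def IsCoordExpr₃ (x : M)
    (B : Π y : M, TangentSpace (𝓡 n) y → TangentSpace (𝓡 n) y → TangentSpace (𝓡 n) y → ℝ)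
    (A : EuclideanSpace ℝ (Fin n) → EuclideanSpace ℝ (Fin n) → EuclideanSpace ℝ (Fin n) →
      EuclideanSpace ℝ (Fin n) → ℝ) : Prop :=
  ∀ y ∈ (extChartAt (𝓡 n) x).source, ∀ u v w : TangentSpace (𝓡 n) y,
    B y u v w = A (extChartAt (𝓡 n) x y) (coord x y u) (coord x y v) (coord x y w)

variable {nabla : Connection n M} {x y : M}

theorem mvfderiv_eq_of_eventually_eq {f : M → ℝ} {F : EuclideanSpace ℝ (Fin n) → ℝ}
    (h : ∀ᶠ y in 𝓝 x, f y = F (extChartAt (𝓡 n) x y))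
    (hF : DifferentiableAt ℝ F (extChartAt (𝓡 n) x x)) (v : TangentSpace (𝓡 n) x) :
    mvfderiv (𝓡 n) f x v = fderiv ℝ F (extChartAt (𝓡 n) x x) (coord x x v) := by
  have hx := mem_extChartAt_source (I := 𝓡 n) x
  have comp_eq := comp_extChartAt_symm_eventuallyEq h
  rw [mvfderiv_eq_of_comp_extChartAt_symm hx (hF.congr_of_eventuallyEq comp_eq),
    comp_eq.fderiv_eq]

theorem coord_ext (hy : y ∈ (extChartAt (𝓡 n) x).source) (u : TangentSpace (𝓡 n) x) :
    coord x y (ext u y) = coord x x u := by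
  rw [ext_eq_constField _ hy, constField, coord_coordSymm hy]

theorem IsCoordExpr₂.mvfderiv_eq
    {B : Π y : M, TangentSpace (𝓡 n) y → TangentSpace (𝓡 n) y → ℝ}
    {A : EuclideanSpace ℝ (Fin n) → EuclideanSpace ℝ (Fin n) → EuclideanSpace ℝ (Fin n) → ℝ}
    (h : IsCoordExpr₂ x B A)
    (hA : ∀ u v, DifferentiableAt ℝ (fun z => A z u v) (extChartAt (𝓡 n) x x))
    (w u v : TangentSpace (𝓡 n) x) :
    mvfderiv (𝓡 n) (fun y => B y (ext u y) (ext v y)) x w =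
      fderiv ℝ (fun z => A z (coord x x u) (coord x x v)) (extChartAt (𝓡 n) x x) (coord x x w) := by
  refine mvfderiv_eq_of_eventually_eq ?_ (hA _ _) w
  filter_upwards [extChartAt_source_mem_nhds (I := 𝓡 n) x] with y hy
  rw [h y hy, coord_ext hy, coord_ext hy]

theorem IsCoordExpr₂.covDeriv_eq
    {B : Π y : M, TangentSpace (𝓡 n) y → TangentSpace (𝓡 n) y → ℝ}
    {A : EuclideanSpace ℝ (Fin n) → EuclideanSpace ℝ (Fin n) → EuclideanSpace ℝ (Fin n) → ℝ}
    (h : IsCoordExpr₂ x B A)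
    (hA : ∀ u v, DifferentiableAt ℝ (fun z => A z u v) (extChartAt (𝓡 n) x x))
    (w u v : TangentSpace (𝓡 n) x) :
    covDeriv₂ nabla B x w u v = coordCovDeriv₂ (christoffel nabla x) A (extChartAt (𝓡 n) x x)
      (coord x x w) (coord x x u) (coord x x v) := by
  have hx := mem_extChartAt_source (I := 𝓡 n) x
  rw [covDeriv₂, h.mvfderiv_eq hA, h x hx, h x hx, coord_connection_ext, coord_connection_ext,
    coordCovDeriv₂]

section Trilinear

variable {B : Π y : M, TangentSpace (𝓡 n) y → TangentSpace (𝓡 n) y → TangentSpace (𝓡 n) y → ℝ}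
  {A : EuclideanSpace ℝ (Fin n) → EuclideanSpace ℝ (Fin n) → EuclideanSpace ℝ (Fin n) →
    EuclideanSpace ℝ (Fin n) → ℝ}

theorem IsCoordExpr₃.mvfderiv_eq (h : IsCoordExpr₃ x B A)
    (hA : ∀ u v w, DifferentiableAt ℝ (fun z => A z u v w) (extChartAt (𝓡 n) x x))
    (t u v w : TangentSpace (𝓡 n) x) :
    mvfderiv (𝓡 n) (fun y => B y (ext u y) (ext v y) (ext w y)) x t =
      fderiv ℝ (fun z => A z (coord x x u) (coord x x v) (coord x x w)) (extChartAt (𝓡 n) x x)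
        (coord x x t) := by
  refine mvfderiv_eq_of_eventually_eq ?_ (hA _ _ _) t
  filter_upwards [extChartAt_source_mem_nhds (I := 𝓡 n) x] with y hy
  rw [h y hy, coord_ext hy, coord_ext hy, coord_ext hy]

theorem IsCoordExpr₃.covDeriv_eq (h : IsCoordExpr₃ x B A)
    (hA : ∀ u v w, DifferentiableAt ℝ (fun z => A z u v w) (extChartAt (𝓡 n) x x))
    (t u v w : TangentSpace (𝓡 n) x) :
    covDeriv₃ nabla B x t u v w = coordCovDeriv₃ (christoffel nabla x) A (extChartAt (𝓡 n) x x)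
      (coord x x t) (coord x x u) (coord x x v) (coord x x w) := by
  have hx := mem_extChartAt_source (I := 𝓡 n) x
  rw [covDeriv₃, h.mvfderiv_eq hA, h x hx, h x hx, h x hx, coord_connection_ext,
    coord_connection_ext, coord_connection_ext, coordCovDeriv₃]

/-- The extensions `ext u` have constant coordinates, so their brackets vanish. -/
theorem IsCoordExpr₃.extDeriv_eq (h : IsCoordExpr₃ x B A)
    (hA : ∀ u v w, DifferentiableAt ℝ (fun z => A z u v w) (extChartAt (𝓡 n) x x))
    (hA₀ : ∀ u v, A (extChartAt (𝓡 n) x x) 0 u v = 0) (u₀ u₁ u₂ u₃ : TangentSpace (𝓡 n) x) :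
    extDeriv₃ B x u₀ u₁ u₂ u₃ = coordExtDeriv₃ A (extChartAt (𝓡 n) x x)
      (coord x x u₀) (coord x x u₁) (coord x x u₂) (coord x x u₃) := by
  have hB₀ : ∀ u v, B x 0 u v = 0 := by
    intro u v
    rw [h x (mem_extChartAt_source (I := 𝓡 n) x), map_zero, hA₀]
  simp only [extDeriv₃, coordExtDeriv₃, mlieBracket_ext, hB₀, h.mvfderiv_eq hA]
  ring

end Trilinear

end CoordinateExpressions

section Constancy

variable {n : ℕ} {M : Type*} [TopologicalSpace M] [ChartedSpace (EuclideanSpace ℝ (Fin n)) M]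
  [IsManifold (𝓡 n) ∞ M] {F : Type*} [NormedAddCommGroup F] [NormedSpace ℝ F] {f : M → F}

theorem hasFDerivAt_comp_extChartAt_symm_zero (hf : ∀ x, HasMFDerivAt (𝓡 n) 𝓘(ℝ, F) f x 0)
    {x : M} {z : EuclideanSpace ℝ (Fin n)} (hz : z ∈ (extChartAt (𝓡 n) x).target) :
    HasFDerivAt (fun z => f ((extChartAt (𝓡 n) x).symm z))
      (0 : EuclideanSpace ℝ (Fin n) →L[ℝ] F) z := by
  have smooth_symm := contMDiffAt_extChartAt_symm (extChartAt_symm_mem_source hz)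
  rw [(extChartAt (𝓡 n) x).right_inv hz] at smooth_symm
  have chain := (hf ((extChartAt (𝓡 n) x).symm z)).comp z
    (smooth_symm.mdifferentiableAt (by simp)).hasMFDerivAt
  rw [ContinuousLinearMap.zero_comp] at chain
  exact hasMFDerivAt_iff_hasFDerivAt.1 chain

theorem isLocallyConstant_of_hasMFDerivAt_zero (hf : ∀ x, HasMFDerivAt (𝓡 n) 𝓘(ℝ, F) f x 0) :
    IsLocallyConstant f := by
  refine (IsLocallyConstant.iff_eventually_eq f).2 fun x => ?_
  have hx := mem_extChartAt_source (I := 𝓡 n) x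
  obtain ⟨r, hr, ball_subset⟩ := Metric.mem_nhds_iff.1 (eventually_mem_extChartAt_target hx)
  filter_upwards [
    (continuousAt_extChartAt (I := 𝓡 n) x).preimage_mem_nhds (Metric.ball_mem_nhds _ hr),
    extChartAt_source_mem_nhds (I := 𝓡 n) x] with y hy_ball hy
  have hasFDerivAt z (hz : z ∈ Metric.ball (extChartAt (𝓡 n) x x) r) :=
    hasFDerivAt_comp_extChartAt_symm_zero hf (ball_subset hz)
  have eq_on_ball := Metric.isOpen_ball.is_const_of_fderiv_eq_zero
    (convex_ball (extChartAt (𝓡 n) x x) r).isPreconnected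
    (fun z hz => (hasFDerivAt z hz).differentiableAt.differentiableWithinAt)
    (fun z hz => (hasFDerivAt z hz).fderiv) hy_ball (Metric.mem_ball_self hr)
  rwa [(extChartAt (𝓡 n) x).left_inv hy, (extChartAt (𝓡 n) x).left_inv hx] at eq_on_ball

theorem exists_eq_const_of_hasMFDerivAt_zero [PreconnectedSpace M]
    (hf : ∀ x, HasMFDerivAt (𝓡 n) 𝓘(ℝ, F) f x 0) : ∃ C, ∀ x, f x = C := by
  obtain _ | ⟨⟨x⟩⟩ := isEmpty_or_nonempty M
  · exact ⟨0, fun x => isEmptyElim x⟩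
  · exact ⟨f x, fun y =>
      (isLocallyConstant_of_hasMFDerivAt_zero hf).apply_eq_of_preconnectedSpace y x⟩

end Constancy

section Identification

variable {n : ℕ} {M : Type*} [TopologicalSpace M] [ChartedSpace (EuclideanSpace ℝ (Fin n)) M]
  [IsManifold (𝓡 n) ∞ M] [Bundle.RiemannianBundle (fun x : M => TangentSpace (𝓡 n) x)]
  {nabla nablaG : Connection n M} {x y : M}

theorem isCoordExpr_torsionForm : IsCoordExpr₃ x (torsionForm nabla)
    (lowerIndex (metricInChart x) (christoffelTorsion nabla x)) :=
  fun _ hy => torsionForm_eq_lowerIndex hy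

theorem isCoordExpr_tensorSq : IsCoordExpr₂ x (tensorSq (torsionForm nabla))
    (coordTensorSq (lowerIndex (metricInChart x) (christoffelTorsion nabla x))
      (frameInChart x)) := by
  intro y hy u v
  simp only [tensorSq, coordTensorSq, torsionForm_eq_lowerIndex hy, frameInChart_extChartAt hy]

theorem normSq_torsionForm_eq_coordNormSq (hy : y ∈ (extChartAt (𝓡 n) x).source) :
    normSq (torsionForm nabla) y =
      coordNormSq (lowerIndex (metricInChart x) (christoffelTorsion nabla x)) (frameInChart x)
        (extChartAt (𝓡 n) x y) := by
  simp only [normSq, coordNormSq, coordTensorSq, torsionForm_eq_lowerIndex hy,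
    frameInChart_extChartAt hy, sq]

theorem curvature₄_eq_coordCurvature (hy : y ∈ (extChartAt (𝓡 n) x).source)
    (hΓ : DifferentiableAt ℝ (christoffel nabla x) (extChartAt (𝓡 n) x y))
    (u v w t : TangentSpace (𝓡 n) y) :
    curvature₄ nabla y u v w t = metricInChart x (extChartAt (𝓡 n) x y)
      (coordCurvature (christoffel nabla x) (extChartAt (𝓡 n) x y) (coord x y u) (coord x y v)
        (coord x y w)) (coord x y t) := by
  rw [curvature₄, ← metricInChart_coord hy, coord_curvature hy hΓ]

theorem ricci_eq_coordRicci (hy : y ∈ (extChartAt (𝓡 n) x).source)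
    (hΓ : DifferentiableAt ℝ (christoffel nabla x) (extChartAt (𝓡 n) x y))
    (u v : TangentSpace (𝓡 n) y) :
    ricci nabla y u v = coordRicci (metricInChart x) (christoffel nabla x) (frameInChart x)
      (extChartAt (𝓡 n) x y) (coord x y u) (coord x y v) := by
  simp only [ricci, coordRicci, curvature₄_eq_coordCurvature hy hΓ, frameInChart_extChartAt hy]

theorem scal_eq_coordScal (hy : y ∈ (extChartAt (𝓡 n) x).source)
    (hΓ : DifferentiableAt ℝ (christoffel nabla x) (extChartAt (𝓡 n) x y)) :
    scal nabla y = coordScal (metricInChart x) (christoffel nabla x) (frameInChart x)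
      (extChartAt (𝓡 n) x y) := by
  simp only [scal, coordScal, ricci_eq_coordRicci hy hΓ, frameInChart_extChartAt hy]

theorem eventually_normSq_torsionForm_eq (nabla : Connection n M) (x : M) :
    ∀ᶠ y in 𝓝 x, normSq (torsionForm nabla) y =
      coordNormSq (lowerIndex (metricInChart x) (christoffelTorsion nabla x)) (frameInChart x)
        (extChartAt (𝓡 n) x y) := by
  filter_upwards [extChartAt_source_mem_nhds (I := 𝓡 n) x] with y hy
  exact normSq_torsionForm_eq_coordNormSq hy

theorem eventually_scal_eq [T2Space M] (h : nabla.ContMDiffCovariantDerivative ∞) (x : M) :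
    ∀ᶠ y in 𝓝 x, scal nabla y = coordScal (metricInChart x) (christoffel nabla x)
      (frameInChart x) (extChartAt (𝓡 n) x y) := by
  filter_upwards [extChartAt_source_mem_nhds (I := 𝓡 n) x,
    (continuousAt_extChartAt (I := 𝓡 n) x).eventually (eventually_differentiableAt_christoffel h x)]
    with y hy hΓ
  exact scal_eq_coordScal hy hΓ

theorem IsNablaEinstein.eventually_coordRicci [T2Space M]
    (hE : IsNablaEinstein nabla) (h : nabla.ContMDiffCovariantDerivative ∞) (x : M) :
    ∀ᶠ z in 𝓝 (extChartAt (𝓡 n) x x), ∃ lam : ℝ, ∀ u v,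
      (coordRicci (metricInChart x) (christoffel nabla x) (frameInChart x) z u v
        + coordRicci (metricInChart x) (christoffel nabla x) (frameInChart x) z v u) / 2 =
      lam * metricInChart x z u v := by
  obtain ⟨lam, einstein⟩ := hE
  filter_upwards [eventually_exists_extChartAt_eq x, eventually_differentiableAt_christoffel h x]
  rintro _ ⟨y, hy, rfl⟩ hΓ
  refine ⟨lam y, fun u v => ?_⟩
  have einstein_at := einstein y (coordSymm x y u) (coordSymm x y v)
  rw [ricci_eq_coordRicci hy hΓ, ricci_eq_coordRicci hy hΓ, ← metricInChart_coord hy]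
    at einstein_at
  simpa only [coord_coordSymm hy] using einstein_at

end Identification

section SkewTorsionConnections

variable {n : ℕ} {M : Type*} [TopologicalSpace M] [ChartedSpace (EuclideanSpace ℝ (Fin n)) M]
  [IsManifold (𝓡 n) ∞ M] [Bundle.RiemannianBundle (fun x : M => TangentSpace (𝓡 n) x)]
  [T2Space M] [IsContMDiffRiemannianBundle (𝓡 n) ∞ (EuclideanSpace ℝ (Fin n))
    (fun x : M => TangentSpace (𝓡 n) x)] {nabla nablaG : Connection n M} {x : M}

theorem differentiableAt_coordScal_christoffel (h : IsMetricWithSkewTorsion nabla) (x : M) :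
    DifferentiableAt ℝ (coordScal (metricInChart x) (christoffel nabla x) (frameInChart x))
      (extChartAt (𝓡 n) x x) := by
  rw [← connectionWithTorsion_christoffel]
  exact ((isSkewTorsionAt_christoffel h x).hasFDerivAt_coordScal
    (isOrthonormalFrameAt_frameInChart x)).differentiableAt

theorem differentiableAt_coordNormSq_christoffel (h : IsMetricWithSkewTorsion nabla) (x : M) :
    DifferentiableAt ℝ (coordNormSq (lowerIndex (metricInChart x) (christoffelTorsion nabla x))
      (frameInChart x)) (extChartAt (𝓡 n) x x) :=
  have h' := isSkewTorsionAt_christoffel h x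
  differentiableAt_coordNormSq h'.toIsLeviCivitaAt (isOrthonormalFrameAt_frameInChart x)
    h'.differentiableAt_torsion.self_of_nhds

theorem mdifferentiableAt_scal (h : IsMetricWithSkewTorsion nabla) (x : M) :
    MDifferentiableAt (𝓡 n) 𝓘(ℝ, ℝ) (scal nabla) x :=
  (hasMFDerivAt_of_comp_extChartAt_symm (mem_extChartAt_source (I := 𝓡 n) x)
    ((differentiableAt_coordScal_christoffel h x).hasFDerivAt.congr_of_eventuallyEq
      (comp_extChartAt_symm_eventuallyEq (eventually_scal_eq h.smooth x)))).mdifferentiableAt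

theorem mdifferentiableAt_normSq_torsionForm (h : IsMetricWithSkewTorsion nabla) (x : M) :
    MDifferentiableAt (𝓡 n) 𝓘(ℝ, ℝ) (normSq (torsionForm nabla)) x :=
  (hasMFDerivAt_of_comp_extChartAt_symm (mem_extChartAt_source (I := 𝓡 n) x)
    ((differentiableAt_coordNormSq_christoffel h x).hasFDerivAt.congr_of_eventuallyEq
      (comp_extChartAt_symm_eventuallyEq
        (eventually_normSq_torsionForm_eq nabla x)))).mdifferentiableAt

theorem mvfderiv_scal (h : IsMetricWithSkewTorsion nabla) (v : TangentSpace (𝓡 n) x) :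
    mvfderiv (𝓡 n) (scal nabla) x v =
      fderiv ℝ (coordScal (metricInChart x) (christoffel nabla x) (frameInChart x))
        (extChartAt (𝓡 n) x x) (coord x x v) :=
  mvfderiv_eq_of_eventually_eq (eventually_scal_eq h.smooth x)
    (differentiableAt_coordScal_christoffel h x) v

theorem mvfderiv_normSq_torsionForm (h : IsMetricWithSkewTorsion nabla)
    (v : TangentSpace (𝓡 n) x) :
    mvfderiv (𝓡 n) (normSq (torsionForm nabla)) x v =
      fderiv ℝ (coordNormSq (lowerIndex (metricInChart x) (christoffelTorsion nabla x))
        (frameInChart x)) (extChartAt (𝓡 n) x x) (coord x x v) :=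
  mvfderiv_eq_of_eventually_eq (eventually_normSq_torsionForm_eq nabla x)
    (differentiableAt_coordNormSq_christoffel h x) v

theorem scal_leviCivita (h : IsMetricWithSkewTorsion nabla) (hG : IsLeviCivita nablaG) (x : M) :
    scal nablaG x = scal nabla x + 1 / 4 * normSq (torsionForm nabla) x := by
  have hx := mem_extChartAt_source (I := 𝓡 n) x
  have h' := isSkewTorsionAt_christoffel h x
  have christoffel_eq := christoffel_eventuallyEq_christoffelSymm h hG x
  have coord_identity := h'.coordScal_leviCivita (isOrthonormalFrameAt_frameInChart x)
  rw [connectionWithTorsion_christoffel] at coord_identity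
  rw [scal_eq_coordScal hx (h'.differentiableAt.congr_of_eventuallyEq christoffel_eq),
    scal_eq_coordScal hx (eventually_differentiableAt_christoffel h.smooth x).self_of_nhds,
    normSq_torsionForm_eq_coordNormSq hx, ← coord_identity, coordScal_congr christoffel_eq]

theorem divergence_tensorSq_eq_coord (h : IsMetricWithSkewTorsion nabla)
    (hG : IsLeviCivita nablaG) (v : TangentSpace (𝓡 n) x) :
    divergence₂ nablaG (tensorSq (torsionForm nabla)) x v =
      ∑ s, coordCovDeriv₂ (christoffelSymm nabla x)
        (coordTensorSq (lowerIndex (metricInChart x) (christoffelTorsion nabla x))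
          (frameInChart x))
        (extChartAt (𝓡 n) x x) (frameInChart x (extChartAt (𝓡 n) x x) s)
        (frameInChart x (extChartAt (𝓡 n) x x) s) (coord x x v) := by
  have hx := mem_extChartAt_source (I := 𝓡 n) x
  have h' := isSkewTorsionAt_christoffel h x
  have christoffel_eq := (christoffel_eventuallyEq_christoffelSymm h hG x).self_of_nhds
  have differentiable := differentiableAt_coordTensorSq h'.toIsLeviCivitaAt
    (isOrthonormalFrameAt_frameInChart x) h'.differentiableAt_torsion.self_of_nhds
  simp only [divergence₂, isCoordExpr_tensorSq.covDeriv_eq differentiable, coordCovDeriv₂,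
    christoffel_eq, frameInChart_extChartAt hx]

theorem codiff_torsionForm_eq_coord (h : IsMetricWithSkewTorsion nabla)
    (hG : IsLeviCivita nablaG) (u v : TangentSpace (𝓡 n) x) :
    codiff₃ nablaG (torsionForm nabla) x u v =
      -∑ s, coordCovDeriv₃ (christoffelSymm nabla x)
        (lowerIndex (metricInChart x) (christoffelTorsion nabla x)) (extChartAt (𝓡 n) x x)
        (frameInChart x (extChartAt (𝓡 n) x x) s) (frameInChart x (extChartAt (𝓡 n) x x) s)
        (coord x x u) (coord x x v) := by
  have hx := mem_extChartAt_source (I := 𝓡 n) x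
  have h' := isSkewTorsionAt_christoffel h x
  have christoffel_eq := (christoffel_eventuallyEq_christoffelSymm h hG x).self_of_nhds
  have differentiable := differentiableAt_lowerIndex h'.toIsLeviCivitaAt
    h'.differentiableAt_torsion.self_of_nhds
  simp only [codiff₃, isCoordExpr_torsionForm.covDeriv_eq differentiable, coordCovDeriv₃,
    christoffel_eq, frameInChart_extChartAt hx]

theorem extDeriv_torsionForm_eq_coord (h : IsMetricWithSkewTorsion nabla)
    (u₀ u₁ u₂ u₃ : TangentSpace (𝓡 n) x) :
    extDeriv₃ (torsionForm nabla) x u₀ u₁ u₂ u₃ =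
      coordExtDeriv₃ (lowerIndex (metricInChart x) (christoffelTorsion nabla x))
        (extChartAt (𝓡 n) x x) (coord x x u₀) (coord x x u₁) (coord x x u₂) (coord x x u₃) := by
  have h' := isSkewTorsionAt_christoffel h x
  exact isCoordExpr_torsionForm.extDeriv_eq
    (differentiableAt_lowerIndex h'.toIsLeviCivitaAt h'.differentiableAt_torsion.self_of_nhds)
    (fun _ _ => by simp [lowerIndex]) u₀ u₁ u₂ u₃

theorem divergence_tensorSq (h : IsMetricWithSkewTorsion nabla) (hG : IsLeviCivita nablaG)
    (v : TangentSpace (𝓡 n) x) :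
    divergence₂ nablaG (tensorSq (torsionForm nabla)) x v =
      -smallTheta nablaG (torsionForm nabla) x v
        + 1 / 6 * mvfderiv (𝓡 n) (normSq (torsionForm nabla)) x v
        - 1 / 3 * bigTheta (torsionForm nabla) x v := by
  have hx := mem_extChartAt_source (I := 𝓡 n) x
  rw [divergence_tensorSq_eq_coord h hG, mvfderiv_normSq_torsionForm h,
    (isSkewTorsionAt_christoffel h x).div_coordTensorSq_eq_extDeriv
      (isOrthonormalFrameAt_frameInChart x)]
  simp only [smallTheta, bigTheta, codiff_torsionForm_eq_coord h hG,
    extDeriv_torsionForm_eq_coord h, torsionForm_eq_lowerIndex hx, frameInChart_extChartAt hx,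
    neg_mul, Finset.sum_neg_distrib, neg_neg]

theorem divergence_tensorSq_of_curvaturePairSymmetric (h : IsMetricWithSkewTorsion nabla)
    (hG : IsLeviCivita nablaG) (hR : CurvaturePairSymmetric nabla) (v : TangentSpace (𝓡 n) x) :
    divergence₂ nablaG (tensorSq (torsionForm nabla)) x v =
      -(1 / 2 * mvfderiv (𝓡 n) (normSq (torsionForm nabla)) x v) := by
  have hx := mem_extChartAt_source (I := 𝓡 n) x
  have hΓ := (eventually_differentiableAt_christoffel h.smooth x).self_of_nhds
  rw [divergence_tensorSq_eq_coord h hG, mvfderiv_normSq_torsionForm h]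
  refine (isSkewTorsionAt_christoffel h x).div_coordTensorSq_of_pair_symm
    (isOrthonormalFrameAt_frameInChart x) (fun u v w t => ?_) _
  have pair_symm := hR x (coordSymm x x u) (coordSymm x x v) (coordSymm x x w) (coordSymm x x t)
  rw [curvature₄_eq_coordCurvature hx hΓ, curvature₄_eq_coordCurvature hx hΓ] at pair_symm
  simpa only [coord_coordSymm hx, connectionWithTorsion_christoffel] using pair_symm

theorem IsNablaEinstein.scal_identity (hE : IsNablaEinstein nabla)
    (h : IsMetricWithSkewTorsion nabla) (hG : IsLeviCivita nablaG) (v : TangentSpace (𝓡 n) x) :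
    ((n : ℝ) - 2) / n * mvfderiv (𝓡 n) (scal nabla) x v
      - 1 / 2 * divergence₂ nablaG (tensorSq (torsionForm nabla)) x v
      + 1 / 4 * mvfderiv (𝓡 n) (normSq (torsionForm nabla)) x v = 0 := by
  obtain rfl | hn := eq_or_ne n 0
  · have : Subsingleton (TangentSpace (𝓡 0) x) :=
      inferInstanceAs (Subsingleton (EuclideanSpace ℝ (Fin 0)))
    simp [divergence₂, Subsingleton.elim v 0]
  · have : Nonempty (Fin n) := Fin.pos_iff_nonempty.1 (Nat.pos_of_ne_zero hn)
    have einstein := hE.eventually_coordRicci h.smooth x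
    rw [← connectionWithTorsion_christoffel] at einstein
    have coord_identity := (isSkewTorsionAt_christoffel h x).einstein_identity
      (isOrthonormalFrameAt_frameInChart x) einstein (coord x x v)
    rwa [Fintype.card_fin, connectionWithTorsion_christoffel, ← mvfderiv_scal h,
      ← mvfderiv_normSq_torsionForm h, ← divergence_tensorSq_eq_coord h hG] at coord_identity

end SkewTorsionConnections

section ScalarCurvatureFormulas

variable {n : ℕ} {M : Type*} [TopologicalSpace M] [ChartedSpace (EuclideanSpace ℝ (Fin n)) M]
  [IsManifold (𝓡 n) ∞ M] [Bundle.RiemannianBundle (fun x : M => TangentSpace (𝓡 n) x)]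
  {nabla nablaG : Connection n M}

section Tensor

variable {T : Π y : M, TangentSpace (𝓡 n) y → TangentSpace (𝓡 n) y → TangentSpace (𝓡 n) y → ℝ}

theorem IsHarmonic₃.three_mul_smallTheta_add_bigTheta
    (hT : IsHarmonic₃ nablaG T) (x : M) (v : TangentSpace (𝓡 n) x) :
    3 * smallTheta nablaG T x v + bigTheta T x v = 0 := by
  simp [smallTheta, bigTheta, hT.1, hT.2]

theorem exists_normSq_eq_of_scal_eq (hn2 : n ≠ 2) {c C : ℝ} (hc : c ≠ 0)
    (hscal : ∀ x, scal nabla x = -(n / (c * (n - 2))) * normSq T x + C)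
    (hconst : ∃ C, ∀ x, scal nabla x = C) : ∃ C, ∀ x, normSq T x = C := by
  obtain rfl | hn := eq_or_ne n 0
  · exact ⟨0, fun x => by simp [normSq]⟩
  · obtain ⟨C', hC'⟩ := hconst
    have factor_ne_zero : (n : ℝ) / (c * (n - 2)) ≠ 0 :=
      div_ne_zero (Nat.cast_ne_zero.2 hn) (mul_ne_zero hc (sub_ne_zero.2 (by exact_mod_cast hn2)))
    refine ⟨(C - C') / (n / (c * (n - 2))), fun x => ?_⟩
    rw [eq_div_iff factor_ne_zero]
    linarith [hscal x, hC' x]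

end Tensor

variable [T2Space M] [IsContMDiffRiemannianBundle (𝓡 n) ∞ (EuclideanSpace ℝ (Fin n))
    (fun x : M => TangentSpace (𝓡 n) x)]

theorem exists_scal_eq_of_mvfderiv_eq [PreconnectedSpace M] (h : IsMetricWithSkewTorsion nabla)
    {k : ℝ} (differential_eq : ∀ (x : M) (v : TangentSpace (𝓡 n) x),
      mvfderiv (𝓡 n) (scal nabla) x v = k * mvfderiv (𝓡 n) (normSq (torsionForm nabla)) x v) :
    ∃ C, ∀ x, scal nabla x = k * normSq (torsionForm nabla) x + C := by
  have derivative_zero : ∀ x, HasMFDerivAt (𝓡 n) 𝓘(ℝ, ℝ)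
      (scal nabla - k • normSq (torsionForm nabla)) x 0 := by
    intro x
    refine ((mdifferentiableAt_scal h x).hasMFDerivAt.sub
      ((mdifferentiableAt_normSq_torsionForm h x).hasMFDerivAt.const_smul k)).congr_mfderiv ?_
    ext v
    exact sub_eq_zero.2 (differential_eq x v)
  obtain ⟨C, hC⟩ := exists_eq_const_of_hasMFDerivAt_zero derivative_zero
  exact ⟨C, fun x => sub_eq_iff_eq_add'.1 (hC x)⟩

theorem IsNablaEinstein.exists_scal_eq [PreconnectedSpace M] (hE : IsNablaEinstein nabla)
    (h : IsMetricWithSkewTorsion nabla) (hG : IsLeviCivita nablaG) (hn2 : n ≠ 2) {c : ℝ}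
    (hc : c ≠ 0) (divergence_eq : ∀ (x : M) (v : TangentSpace (𝓡 n) x),
      divergence₂ nablaG (tensorSq (torsionForm nabla)) x v =
        (1 / 2 - 2 / c) * mvfderiv (𝓡 n) (normSq (torsionForm nabla)) x v) :
    ∃ C, ∀ x, scal nabla x = -(n / (c * (n - 2))) * normSq (torsionForm nabla) x + C := by
  obtain rfl | hn := eq_or_ne n 0
  · exact ⟨0, fun x => by simp [scal]⟩
  · refine exists_scal_eq_of_mvfderiv_eq h fun x v => ?_
    have hn' : (n : ℝ) ≠ 0 := Nat.cast_ne_zero.2 hn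
    have hn2' : (n : ℝ) - 2 ≠ 0 := sub_ne_zero.2 (by exact_mod_cast hn2)
    have identity := hE.scal_identity h hG v
    rw [divergence_eq] at identity
    field_simp at identity ⊢
    linarith

theorem IsNablaEinstein.exists_scal_eq_of_theta [PreconnectedSpace M] (hE : IsNablaEinstein nabla)
    (h : IsMetricWithSkewTorsion nabla) (hG : IsLeviCivita nablaG) (hn2 : n ≠ 2)
    (hθ : ∀ (x : M) (v : TangentSpace (𝓡 n) x),
      3 * smallTheta nablaG (torsionForm nabla) x v + bigTheta (torsionForm nabla) x v = 0) :
    ∃ C, ∀ x, scal nabla x = -(n / (6 * (n - 2))) * normSq (torsionForm nabla) x + C := by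
  refine hE.exists_scal_eq h hG hn2 (by norm_num) fun x v => ?_
  rw [divergence_tensorSq h hG]
  linarith [hθ x v]

theorem IsNablaEinstein.exists_scal_eq_of_curvaturePairSymmetric [PreconnectedSpace M]
    (hE : IsNablaEinstein nabla) (h : IsMetricWithSkewTorsion nabla) (hG : IsLeviCivita nablaG)
    (hn2 : n ≠ 2) (hR : CurvaturePairSymmetric nabla) :
    ∃ C, ∀ x, scal nabla x = -(n / (2 * (n - 2))) * normSq (torsionForm nabla) x + C := by
  refine hE.exists_scal_eq h hG hn2 (by norm_num) fun x v => ?_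
  rw [divergence_tensorSq_of_curvaturePairSymmetric h hG hR]
  ring

end ScalarCurvatureFormulas

end SkewTorsion

theorem mainTheorem4 (n : ℕ) {M : Type*} [TopologicalSpace M] [T2Space M]
    [ChartedSpace (EuclideanSpace ℝ (Fin n)) M] [IsManifold (𝓡 n) ∞ M]
    [Bundle.RiemannianBundle (fun x : M => TangentSpace (𝓡 n) x)]
    [IsContMDiffRiemannianBundle (𝓡 n) ∞ (EuclideanSpace ℝ (Fin n))
      (fun x : M => TangentSpace (𝓡 n) x)]
    (nabla nablaG : SkewTorsion.Connection n M)
    (hnabla : SkewTorsion.IsMetricWithSkewTorsion nabla)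
    (hnablaG : SkewTorsion.IsLeviCivita nablaG)
    (T : Π x : M, TangentSpace (𝓡 n) x → TangentSpace (𝓡 n) x → TangentSpace (𝓡 n) x → ℝ)
    (hT : T = SkewTorsion.torsionForm nabla)
    (hE : SkewTorsion.IsNablaEinstein nabla) :
    -- a)
    (∀ (x : M) (v : TangentSpace (𝓡 n) x),
      ((n : ℝ) - 2) / n * mvfderiv (𝓡 n) (SkewTorsion.scal nabla) x v
        - 1 / 2 * SkewTorsion.divergence₂ nablaG (SkewTorsion.tensorSq T) x v
        + 1 / 4 * mvfderiv (𝓡 n) (SkewTorsion.normSq T) x v = 0) ∧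
    -- b)
    (PreconnectedSpace M → n ≠ 2 →
      ((∀ (x : M) (v : TangentSpace (𝓡 n) x),
          3 * SkewTorsion.smallTheta nablaG T x v + SkewTorsion.bigTheta T x v = 0) ∨
        SkewTorsion.IsHarmonic₃ nablaG T) →
      (∃ C : ℝ, ∀ x : M,
        SkewTorsion.scal nabla x
            = -((n : ℝ) / (6 * ((n : ℝ) - 2))) * SkewTorsion.normSq T x + C ∧
          SkewTorsion.scal nablaG x
            = SkewTorsion.scal nabla x + 1 / 4 * SkewTorsion.normSq T x ∧
          SkewTorsion.scal nablaG x
            = ((n : ℝ) - 6) / (12 * ((n : ℝ) - 2)) * SkewTorsion.normSq T x + C) ∧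
        ((∃ c : ℝ, ∀ x : M, SkewTorsion.scal nabla x = c) →
          ∃ c : ℝ, ∀ x : M, SkewTorsion.normSq T x = c)) ∧
    -- c)
    (PreconnectedSpace M → n ≠ 2 → SkewTorsion.CurvaturePairSymmetric nabla →
      (∃ B : ℝ, ∀ x : M,
        SkewTorsion.scal nabla x
            = -((n : ℝ) / (2 * ((n : ℝ) - 2))) * SkewTorsion.normSq T x + B ∧
          SkewTorsion.scal nablaG x
            = -(((n : ℝ) + 2) / (4 * ((n : ℝ) - 2))) * SkewTorsion.normSq T x + B) ∧
        ((∃ c : ℝ, ∀ x : M, SkewTorsion.scal nabla x = c) →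
          ∃ c : ℝ, ∀ x : M, SkewTorsion.normSq T x = c)) := by
  subst hT
  refine ⟨fun x v => hE.scal_identity hnabla hnablaG v, fun _ hn2 hθ => ?_, fun _ hn2 hR => ?_⟩
  · have hn2' : (n : ℝ) - 2 ≠ 0 := sub_ne_zero.2 (by exact_mod_cast hn2)
    obtain ⟨C, hC⟩ := hE.exists_scal_eq_of_theta hnabla hnablaG hn2
      (hθ.elim id fun hT => hT.three_mul_smallTheta_add_bigTheta)
    have hG := SkewTorsion.scal_leviCivita hnabla hnablaG
    refine ⟨⟨C, fun x => ⟨hC x, hG x, ?_⟩⟩,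
      SkewTorsion.exists_normSq_eq_of_scal_eq hn2 (by norm_num) hC⟩
    rw [hG, hC]
    field_simp
    ring
  · have hn2' : (n : ℝ) - 2 ≠ 0 := sub_ne_zero.2 (by exact_mod_cast hn2)
    obtain ⟨B, hB⟩ := hE.exists_scal_eq_of_curvaturePairSymmetric hnabla hnablaG hn2 hR
    refine ⟨⟨B, fun x => ⟨hB x, ?_⟩⟩,
      SkewTorsion.exists_normSq_eq_of_scal_eq hn2 (by norm_num) hB⟩
    rw [SkewTorsion.scal_leviCivita hnabla hnablaG, hB]
    field_simp
    ring
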